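/- Let $\mathcal X,\mathcal Y$ be finite alphabets, $W=\{W(y|x)\}$ the transition matrix of a discrete memoryless channel, and $P_X$ a distribution on $\mathcal X$ whose type class $\mathcal T_{P_X}\subseteq\mathcal X^n$ (the vectors with empirical distribution $P_X$) is non-empty for some $n\ge 1$. Logarithms are natural, $\log 0=-\infty$ and $0\cdot(-\infty)=0$. *Exponents.* For a rate $R$ let $M=\lfloor e^{nR}\rfloor$ codewords $\mathbf x_1,\dots,\mathbf x_M$ be drawn independently and uniformly from $\mathcal T_{P_X}$. A decoder $\phi$ maps each $\mathbf y\in\mathcal Y^n$ to a list of messages. Let $\overline{P_e}$ be the probability that the transmitted message is not on the list, and $\overline L$ the expected number of wrong messages on the list, both averaged over a uniform message, the channel and the random codebook. Put $E_e(R,\phi)=\liminf -\frac1n\log\overline{P_e}$ and $E_l(R,\phi)=\liminf -\frac1n\log\overline L$ in $[-\infty,\infty]$, as $n\to\infty$ along the $n$ with $\mathcal T_{P_X}\neq\emptyset$. *Classes.* Let $f(Q)=\sum_{x,y}Q(x,y)\log W(y|x)$ and let $\hat Q$ denote empirical (joint) distributions. A threshold function on a simplex is real-valued and continuous on some compact subset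 and $+\infty$ elsewhere. The class $\Psi$ consists of the decoders which put $m$ on the list iff $f(\hat Q_{\mathbf x_m\mathbf y})\ge\max_{l\ne m}h(\hat Q_{\mathbf x_l\mathbf y})$, for a threshold function $h$ on the distributions on $\mathcal X\times\mathcal Y$. The class $\Lambda_1$ consists of those which put $m$ on the list iff $f(\hat Q_{\mathbf x_m\mathbf y})\ge g(\hat Q_{\mathbf y})$, for a threshold function $g$ on the distributions on $\mathcal Y$. For $K\in\{\Lambda_1,\Psi\}$ and a real target $\mathsf E$, let $E_l^*(K,R,\mathsf E)$ be the largest $E_l(R,\phi)$ over the decoders $\phi\in K$ with $E_e(R,\phi)\ge\mathsf E$; a $\phi$ attaining it is called optimal in $K$. *Critical rate.* Let $Q,\tilde Q,Q'$ range over the joint distributions with $X$-marginal $P_X$, let $I$ be the mutual information and $D(\cdot\|W|P_X)$ the conditional divergence, and put $g^*(Q_Y,\mathsf E)=\min\{f(Q'):Q'_Y=Q_Y,\ D(Q'_{Y|X}\|W|P_X)\le\mathsf E\}$ ($+\infty$ if there is no such $Q'$). Let $(\tilde Q^*,Q^*)$ be an optimal solution of $$\min\bigl\{D(\tilde Q_{Y|X}\|W|P_X)+I(Q)\;:\;Q_Y=\tilde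 Q_Y,\ g^*(Q_Y,\mathsf E)\le f(Q)\bigr\},$$ and put $\overline R_{cr}(\mathsf E)=I(\tilde Q^*)$. *Claim.* Let $R\ge\overline R_{cr}(\mathsf E)$ and, in the boundary case $R=\overline R_{cr}(\mathsf E)$, let all $W(y|x)$ be positive. Then there are optimal decoders in $\Lambda_1$ and in $\Psi$, and $$E_l^*(\Lambda_1,R,\mathsf E)=E_l^*(\Psi,R,\mathsf E).$$ -/

import Mathlib

open Filter
open scoped BigOperators

namespace ErasureList

noncomputable section

/-! ### Finite distributions, types and information measures

A distribution on a finite alphabet is a real function on it; a joint distribution of `(X, Y)` is a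
function on `X × Y`.  A channel is a function `W : X → Y → ℝ`, where `W x y` is the probability of
the output letter `y` given the input letter `x`. -/

/-- The `X`-marginal of a joint distribution. -/
def margX {X Y : Type*} [Fintype Y] (Q : X × Y → ℝ) : X → ℝ := fun x => ∑ y, Q (x, y)

/-- The `Y`-marginal of a joint distribution. -/
def margY {X Y : Type*} [Fintype X] (Q : X × Y → ℝ) : Y → ℝ := fun y => ∑ x, Q (x, y)

/-- The joint distributions on `X × Y` whose `X`-marginal is `P`. -/
def jointDist {X Y : Type*} [Fintype X] [Fintype Y] (P : X → ℝ) : Set (X × Y → ℝ) :=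
  {Q | Q ∈ stdSimplex ℝ (X × Y) ∧ margX Q = P}

/-- The empirical distribution of a vector: relative frequencies of the letters. -/
def empDist {α : Type*} [DecidableEq α] {n : ℕ} (x : Fin n → α) : α → ℝ :=
  fun a => ((Finset.univ.filter fun i => x i = a).card : ℝ) / n

/-- The empirical joint distribution of a pair of vectors. -/
def jointEmpDist {X Y : Type*} [DecidableEq X] [DecidableEq Y] {n : ℕ}
    (x : Fin n → X) (y : Fin n → Y) : X × Y → ℝ :=
  empDist fun i => (x i, y i)

open Classical in
/-- The type class of `P` in blocklength `n`. -/
def typeClass {X : Type*} [Fintype X] [DecidableEq X] (P : X → ℝ) (n : ℕ) :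
    Finset (Fin n → X) :=
  Finset.univ.filter fun x => empDist x = P

/-- The mutual information of a joint distribution (natural logarithm). -/
def mutualInfo {X Y : Type*} [Fintype X] [Fintype Y] (Q : X × Y → ℝ) : ℝ :=
  ∑ x, ∑ y, Q (x, y) * Real.log (Q (x, y) / (margX Q x * margY Q y))

open Classical in
/-- The conditional divergence `D(Q_{Y|X} ‖ W | Q_X)`; it is infinite as soon as `Q` charges a
forbidden transition of `W`. -/
def condDiv {X Y : Type*} [Fintype X] [Fintype Y] (W : X → Y → ℝ) (Q : X × Y → ℝ) : EReal :=
  if ∃ x y, 0 < Q (x, y) ∧ W x y = 0 then ⊤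
  else ((∑ x, ∑ y, Q (x, y) * Real.log ((Q (x, y) / margX Q x) / W x y) : ℝ) : EReal)

/-- The normalized log-likelihood `f(Q) = ∑ Q(x,y) log W(y|x)`, with `log 0 = -∞` and
`0 · (-∞) = 0`. -/
def logLik {X Y : Type*} [Fintype X] [Fintype Y] (W : X → Y → ℝ) (Q : X × Y → ℝ) : EReal :=
  ∑ x, ∑ y, (Q (x, y) : EReal) * ENNReal.log (ENNReal.ofReal (W x y))

/-! ### Codes, decoders and random coding exponents -/

/-- An erasure/list decoder for every blocklength `n`, number of codewords `M` and codebook: it maps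
an output vector to the list of the messages that are output. -/
abbrev Decoder (X Y : Type*) :=
  (n M : ℕ) → (Fin M → Fin n → X) → (Fin n → Y) → Finset (Fin M)

/-- The memoryless transition probability of vectors. -/
def vecProb {X Y : Type*} (W : X → Y → ℝ) {n : ℕ} (x : Fin n → X) (y : Fin n → Y) : ℝ :=
  ∏ i, W (x i) (y i)

/-- The probability that the transmitted codeword is not on the list, averaged over the messages. -/
def errorProb {X Y : Type*} [Fintype Y] (W : X → Y → ℝ) (φ : Decoder X Y) {n M : ℕ}
    (C : Fin M → Fin n → X) : ℝ :=
  (1 / (M : ℝ)) * ∑ m, ∑ y : Fin n → Y, if m ∈ φ n M C y then 0 else vecProb W (C m) y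

/-- The average number of erroneous codewords on the list. -/
def listSize {X Y : Type*} [Fintype Y] (W : X → Y → ℝ) (φ : Decoder X Y) {n M : ℕ}
    (C : Fin M → Fin n → X) : ℝ :=
  ∑ y : Fin n → Y, (1 / (M : ℝ)) * ∑ m, vecProb W (C m) y *
    ∑ l ∈ Finset.univ.filter (fun l => l ≠ m), if l ∈ φ n M C y then (1 : ℝ) else 0

/-- The number of codewords at rate `R` (in nats) and blocklength `n`. -/
def numCodewords (R : ℝ) (n : ℕ) : ℕ := ⌊Real.exp (n * R)⌋₊

/-- The average of a function of the codebook over the fixed composition ensemble: `M` codewords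
drawn independently and uniformly from the type class of `P`. -/
def ensembleAvg {X : Type*} [Fintype X] [DecidableEq X] (P : X → ℝ) (n M : ℕ)
    (F : (Fin M → Fin n → X) → ℝ) : ℝ :=
  𝔼 C ∈ Fintype.piFinset (fun _ : Fin M => typeClass P n), F C

/-- The blocklengths tending to infinity along those for which the type class is non-empty. -/
def blocklengths {X : Type*} [Fintype X] [DecidableEq X] (P : X → ℝ) : Filter ℕ :=
  atTop ⊓ 𝓟 {n | (typeClass P n).Nonempty}

/-- `liminf -(1/n) log a_n` in the extended reals, with `log 0 = -∞`. -/
def decayExponent {X : Type*} [Fintype X] [DecidableEq X] (P : X → ℝ) (a : ℕ → ℝ) : EReal :=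
  liminf (fun n : ℕ => ((-(1 / (n : ℝ)) : ℝ) : EReal) * ENNReal.log (ENNReal.ofReal (a n)))
    (blocklengths P)

/-- The random coding error exponent. -/
def errorExponent {X Y : Type*} [Fintype X] [DecidableEq X] [Fintype Y]
    (P : X → ℝ) (W : X → Y → ℝ) (R : ℝ) (φ : Decoder X Y) : EReal :=
  decayExponent P fun n => ensembleAvg P n (numCodewords R n) fun C => errorProb W φ C

/-- The random coding list size exponent. -/
def listExponent {X Y : Type*} [Fintype X] [DecidableEq X] [Fintype Y]
    (P : X → ℝ) (W : X → Y → ℝ) (R : ℝ) (φ : Decoder X Y) : EReal :=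
  decayExponent P fun n => ensembleAvg P n (numCodewords R n) fun C => listSize W φ C

/-! ### The two classes of threshold decoders -/

/-- A threshold function on the simplex: real-valued and continuous on a compact set of
distributions, and `+∞` elsewhere. -/
def IsThreshold {α : Type*} [Fintype α] (h : (α → ℝ) → EReal) : Prop :=
  ∃ G : Set (α → ℝ), G ⊆ stdSimplex ℝ α ∧ IsCompact G ∧ ContinuousOn h G ∧
    (∀ Q ∈ G, h Q ≠ ⊥ ∧ h Q ≠ ⊤) ∧ ∀ Q, Q ∉ G → h Q = ⊤

open Classical in
/-- Message `m` is on the list iff its log-likelihood is at least `h` of the joint type of every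
competing codeword with the output vector. -/
def jointThresholdDecoder {X Y : Type*} [Fintype X] [DecidableEq X] [Fintype Y] [DecidableEq Y]
    (W : X → Y → ℝ) (h : (X × Y → ℝ) → EReal) : Decoder X Y :=
  fun _ _ C y => Finset.univ.filter fun m =>
    (⨆ l, ⨆ _ : l ≠ m, h (jointEmpDist (C l) y)) ≤ logLik W (jointEmpDist (C m) y)

open Classical in
/-- Message `m` is on the list iff its log-likelihood is at least `g` of the type of the output
vector. -/
def outputThresholdDecoder {X Y : Type*} [Fintype X] [DecidableEq X] [Fintype Y] [DecidableEq Y]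
    (W : X → Y → ℝ) (g : (Y → ℝ) → EReal) : Decoder X Y :=
  fun _ _ C y => Finset.univ.filter fun m =>
    g (empDist y) ≤ logLik W (jointEmpDist (C m) y)

/-- The class `Ψ` of threshold decoders. -/
def classPsi {X Y : Type*} [Fintype X] [DecidableEq X] [Fintype Y] [DecidableEq Y]
    (W : X → Y → ℝ) : Set (Decoder X Y) :=
  {φ | ∃ h : (X × Y → ℝ) → EReal, IsThreshold h ∧ φ = jointThresholdDecoder W h}

/-- The simplified class `Λ₁`: the threshold depends only on the output vector. -/
def classLambdaOne {X Y : Type*} [Fintype X] [DecidableEq X] [Fintype Y] [DecidableEq Y]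
    (W : X → Y → ℝ) : Set (Decoder X Y) :=
  {φ | ∃ g : (Y → ℝ) → EReal, IsThreshold g ∧ φ = outputThresholdDecoder W g}

/-- `φ` is optimal in the class `K` at rate `R` and target error exponent `E`. -/
def IsOptimalDecoder {X Y : Type*} [Fintype X] [DecidableEq X] [Fintype Y]
    (K : Set (Decoder X Y)) (P : X → ℝ) (W : X → Y → ℝ) (R E : ℝ) (φ : Decoder X Y) : Prop :=
  φ ∈ K ∧ (E : EReal) ≤ errorExponent P W R φ ∧
    ∀ ψ ∈ K, (E : EReal) ≤ errorExponent P W R ψ → listExponent P W R ψ ≤ listExponent P W R φ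

/-- The optimal list size exponent `E_l^*(K, R, E)` of the class `K`: the largest list size exponent
among its decoders with error exponent at least `E`. -/
def optimalListExponent {X Y : Type*} [Fintype X] [DecidableEq X] [Fintype Y]
    (K : Set (Decoder X Y)) (P : X → ℝ) (W : X → Y → ℝ) (R E : ℝ) : EReal :=
  sSup {e | ∃ φ ∈ K, (E : EReal) ≤ errorExponent P W R φ ∧ e = listExponent P W R φ}

/-! ### The critical rate -/

/-- `g^*(q, E)`: the least log-likelihood `f(Q')` over the joint distributions `Q'` with marginals
`P` and `q` and conditional divergence at most `E` (`+∞` if there is none). -/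
def optimalOutputThreshold {X Y : Type*} [Fintype X] [Fintype Y]
    (P : X → ℝ) (W : X → Y → ℝ) (E : ℝ) (q : Y → ℝ) : EReal :=
  sInf {v | ∃ Q' ∈ jointDist (Y := Y) P, margY Q' = q ∧ condDiv W Q' ≤ (E : EReal) ∧
    v = logLik W Q'}

/-- The feasible pairs `(Q̃, Q)` of the minimization of `D(Q̃_{Y|X} ‖ W | P) + I(Q) - R`. -/
def feasiblePairs {X Y : Type*} [Fintype X] [Fintype Y]
    (P : X → ℝ) (W : X → Y → ℝ) (E : ℝ) : Set ((X × Y → ℝ) × (X × Y → ℝ)) :=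
  {p | p.1 ∈ jointDist P ∧ p.2 ∈ jointDist P ∧ margY p.2 = margY p.1 ∧
    optimalOutputThreshold P W E (margY p.2) ≤ logLik W p.2}

/-- `r` is a critical rate for the target error exponent `E`: it is `I(Q̃^*)` for an optimal pair
`(Q̃^*, Q^*)`.  The constant `-R` in the objective does not change the optimal pairs and is
omitted. -/
def IsCriticalRate {X Y : Type*} [Fintype X] [Fintype Y]
    (P : X → ℝ) (W : X → Y → ℝ) (E r : ℝ) : Prop :=
  ∃ p ∈ feasiblePairs P W E,
    (∀ p' ∈ feasiblePairs P W E,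
      condDiv W p.1 + (mutualInfo p.2 : EReal) ≤ condDiv W p'.1 + (mutualInfo p'.2 : EReal)) ∧
    r = mutualInfo p.1

end

end ErasureList

/-! Write `D` for the conditional divergence, `I` for the mutual information and `f` for the
log-likelihood. By the method of types, up to polynomial factors, a transmitted codeword has joint
type `Q̃` with the output with probability `exp(-n D(Q̃))`, and an independent codeword has joint
type `Q` with a fixed output of the right type with probability `exp(-n I(Q))`.

For a target `E > 0` take the output threshold `g^*`. An erased codeword then has a joint type of
divergence above `E`, which gives error exponent at least `E` (`le_errorExponent_optimal`). A union
bound gives list exponent at least `V - R`, where `V` is the minimum defining the critical rate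
(`le_listExponent_optimal`). Continuity of `g^*` on its compact domain rests on the strict convexity
of `D` (`isThreshold_optimalOutputThreshold`).

The converse covers every joint threshold `h` with error exponent at least `E`. Let `D(Q') < E`. A
joint type with `I` at most about `R` occurs among the competitors with probability that is not
exponentially small, up to an arbitrarily small exponent. If `h` exceeded `f(Q')` there, the error
probability would be too large, so `h ≤ f(Q')` on all such types with the output marginal of `Q'`
(`threshold_le_of_errorProb_lt`). Now let `f(Q) ≥ f(Q')`. A wrong codeword of joint type `Q` can
only be kept off the list by a competitor of mutual information above `R`. With high probability no
other wrong codeword is of that kind, and the transmitted one, of type `Q̃`, is not either when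
`I(Q̃) < R`. Hence the list exponent is at most `D(Q̃) + I(Q) - R`
(`listExponent_joint_le_of_types`). At an optimal pair this equals `V - R`, and `R ≥ I(Q̃^*)` is the
critical rate condition.

Real distributions are replaced by types through a `ℚ`-linear map that keeps marginals and zeros
(`exists_types_mem_nhds`). Only strict inequalities survive this, so the optimal pair is first
perturbed (`listExponent_joint_le_of_feasible`). On the boundary `I(Q̃^*) = R` the perturbation goes
towards a product distribution, which is why `W` must be positive there.

Finally, an output threshold lifts to a joint threshold with the same list exponent and no smaller
error exponent. A `g` that beats all joint thresholds is therefore optimal in both classes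
(`optimal_of_forall_joint_le`). -/

namespace ErasureList

noncomputable section

set_option linter.unusedSectionVars false

/-! ### Real-valued forms of the information measures -/

/-- The Shannon entropy in nats. -/
def ent {α : Type*} [Fintype α] (p : α → ℝ) : ℝ := ∑ a, Real.negMulLog (p a)

/-- The normalized log-likelihood as a real linear functional (with `log 0 = 0`). -/
def llr {X Y : Type*} [Fintype X] [Fintype Y] (W : X → Y → ℝ) (Q : X × Y → ℝ) : ℝ :=
  ∑ x, ∑ y, Q (x, y) * Real.log (W x y)

/-- The conditional divergence of a joint distribution with `X`-marginal `P`, as a real number. -/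
def divR {X Y : Type*} [Fintype X] [Fintype Y] (P : X → ℝ) (W : X → Y → ℝ) (Q : X × Y → ℝ) : ℝ :=
  ent P - ent Q - llr W Q

/-- The joint distributions with `X`-marginal `P` that charge no forbidden transition of `W`. -/
def admissible {X Y : Type*} [Fintype X] [Fintype Y] (P : X → ℝ) (W : X → Y → ℝ) :
    Set (X × Y → ℝ) :=
  {Q | Q ∈ jointDist P ∧ ∀ x y, W x y = 0 → Q (x, y) = 0}

section Info

variable {X Y : Type*} [Fintype X] [Fintype Y] {P : X → ℝ} {W : X → Y → ℝ} {Q Q' : X × Y → ℝ}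

theorem coe_sum_ereal {ι : Type*} (s : Finset ι) (f : ι → ℝ) :
    ((∑ i ∈ s, f i : ℝ) : EReal) = ∑ i ∈ s, (f i : EReal) := by
  classical
  induction s using Finset.induction_on with
  | empty => simp
  | insert a s ha ih => rw [Finset.sum_insert ha, Finset.sum_insert ha, EReal.coe_add, ih]

theorem sum_ereal_eq_bot {ι : Type*} {s : Finset ι} {f : ι → EReal} {i : ι} (hi : i ∈ s)
    (h : f i = ⊥) : ∑ i ∈ s, f i = ⊥ := by
  classical
  rw [← Finset.add_sum_erase s f hi, h, EReal.bot_add]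

theorem logLik_eq_coe (hW : ∀ x, W x ∈ stdSimplex ℝ Y) (hQ : ∀ x y, W x y = 0 → Q (x, y) = 0) :
    logLik W Q = (llr W Q : EReal) := by
  unfold logLik llr
  rw [coe_sum_ereal]
  refine Finset.sum_congr rfl fun x _ => ?_
  rw [coe_sum_ereal]
  refine Finset.sum_congr rfl fun y _ => ?_
  rcases (hW x).1 y |>.eq_or_lt with h | h
  · rw [hQ x y h.symm]; simp
  · rw [ENNReal.log_ofReal_of_pos h, EReal.coe_mul]

theorem logLik_eq_bot (hQ : ∀ a, 0 ≤ Q a) {x : X} {y : Y} (hW : W x y = 0) (h : Q (x, y) ≠ 0) :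
    logLik W Q = ⊥ := by
  unfold logLik
  refine sum_ereal_eq_bot (Finset.mem_univ x) (sum_ereal_eq_bot (Finset.mem_univ y) ?_)
  rw [hW]
  simp only [ENNReal.ofReal_zero, ENNReal.log_zero]
  exact EReal.coe_mul_bot_of_pos (lt_of_le_of_ne (hQ _) (Ne.symm h))

theorem eq_zero_of_logLik_ne_bot (hQ : ∀ a, 0 ≤ Q a) (h : logLik W Q ≠ ⊥) (x : X) (y : Y)
    (hxy : W x y = 0) : Q (x, y) = 0 := by
  by_contra hne
  exact h (logLik_eq_bot hQ hxy hne)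

theorem margX_nonneg (hQ : ∀ a, 0 ≤ Q a) (x : X) : 0 ≤ margX Q x :=
  Finset.sum_nonneg fun _ _ => hQ _

theorem margY_nonneg (hQ : ∀ a, 0 ≤ Q a) (y : Y) : 0 ≤ margY Q y :=
  Finset.sum_nonneg fun _ _ => hQ _

theorem le_margX (hQ : ∀ a, 0 ≤ Q a) (x : X) (y : Y) : Q (x, y) ≤ margX Q x :=
  Finset.single_le_sum (f := fun y => Q (x, y)) (fun _ _ => hQ _) (Finset.mem_univ y)

theorem le_margY (hQ : ∀ a, 0 ≤ Q a) (x : X) (y : Y) : Q (x, y) ≤ margY Q y :=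
  Finset.single_le_sum (f := fun x => Q (x, y)) (fun _ _ => hQ _) (Finset.mem_univ x)

theorem sum_eq_sum_margX (Q : X × Y → ℝ) : ∑ a, Q a = ∑ x, margX Q x :=
  Fintype.sum_prod_type _

theorem sum_eq_sum_margY (Q : X × Y → ℝ) : ∑ a, Q a = ∑ y, margY Q y :=
  Fintype.sum_prod_type_right _

theorem margY_mem_stdSimplex (hQ : Q ∈ stdSimplex ℝ (X × Y)) : margY Q ∈ stdSimplex ℝ Y :=
  ⟨margY_nonneg hQ.1, by rw [← sum_eq_sum_margY]; exact hQ.2⟩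

theorem margX_mem_stdSimplex (hQ : Q ∈ stdSimplex ℝ (X × Y)) : margX Q ∈ stdSimplex ℝ X :=
  ⟨margX_nonneg hQ.1, by rw [← sum_eq_sum_margX]; exact hQ.2⟩

theorem sum_mul_log_margX (Q : X × Y → ℝ) :
    ∑ x, ∑ y, Q (x, y) * Real.log (margX Q x) = - ent (margX Q) := by
  unfold ent
  rw [← Finset.sum_neg_distrib]
  refine Finset.sum_congr rfl fun x _ => ?_
  rw [← Finset.sum_mul]
  simp [Real.negMulLog, margX]

theorem sum_mul_log_margY (Q : X × Y → ℝ) :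
    ∑ x, ∑ y, Q (x, y) * Real.log (margY Q y) = - ent (margY Q) := by
  unfold ent
  rw [← Finset.sum_neg_distrib, Finset.sum_comm]
  refine Finset.sum_congr rfl fun x _ => ?_
  rw [← Finset.sum_mul]
  simp [Real.negMulLog, margY]

theorem sum_mul_log_self (Q : X × Y → ℝ) :
    ∑ x, ∑ y, Q (x, y) * Real.log (Q (x, y)) = - ent Q := by
  unfold ent
  rw [Fintype.sum_prod_type, ← Finset.sum_neg_distrib]
  refine Finset.sum_congr rfl fun x _ => ?_
  rw [← Finset.sum_neg_distrib]
  simp [Real.negMulLog]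

theorem mutualInfo_eq (hQ : ∀ a, 0 ≤ Q a) :
    mutualInfo Q = ent (margX Q) + ent (margY Q) - ent Q := by
  have : mutualInfo Q = ∑ x, ∑ y, (Q (x, y) * Real.log (Q (x, y))
      - Q (x, y) * Real.log (margX Q x) - Q (x, y) * Real.log (margY Q y)) := by
    unfold mutualInfo
    refine Finset.sum_congr rfl fun x _ => Finset.sum_congr rfl fun y _ => ?_
    rcases (hQ (x, y)).eq_or_lt with h | h
    · simp [← h]
    · have h1 := h.trans_le (le_margX hQ x y)
      have h2 := h.trans_le (le_margY hQ x y)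
      rw [Real.log_div h.ne' (mul_pos h1 h2).ne', Real.log_mul h1.ne' h2.ne']
      ring
  rw [this]
  simp only [Finset.sum_sub_distrib, sum_mul_log_self, sum_mul_log_margX, sum_mul_log_margY]
  ring

theorem condDiv_eq_coe (hQ : Q ∈ admissible P W) :
    condDiv W Q = (divR P W Q : EReal) := by
  have h0 := hQ.1.1.1
  unfold condDiv
  rw [if_neg (by rintro ⟨x, y, h1, h2⟩; exact h1.ne' (hQ.2 x y h2))]
  congr 1
  have : (∑ x, ∑ y, Q (x, y) * Real.log ((Q (x, y) / margX Q x) / W x y)) =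
      ∑ x, ∑ y, (Q (x, y) * Real.log (Q (x, y))
      - Q (x, y) * Real.log (margX Q x) - Q (x, y) * Real.log (W x y)) := by
    refine Finset.sum_congr rfl fun x _ => Finset.sum_congr rfl fun y _ => ?_
    rcases (h0 (x, y)).eq_or_lt with h | h
    · simp [← h]
    · have h1 := h.trans_le (le_margX h0 x y)
      have h2 : W x y ≠ 0 := fun h' => h.ne' (hQ.2 x y h')
      rw [Real.log_div (div_pos h h1).ne' h2, Real.log_div h.ne' h1.ne']
      ring
  rw [this]
  have hX := sum_mul_log_margX Q
  rw [hQ.1.2] at hX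
  simp only [Finset.sum_sub_distrib, sum_mul_log_self, hQ.1.2, hX]
  unfold divR llr
  ring

theorem admissible_of_condDiv_ne_top (hQ : Q ∈ jointDist P) (h : condDiv W Q ≠ ⊤) :
    Q ∈ admissible P W := by
  refine ⟨hQ, fun x y hxy => ?_⟩
  by_contra hne
  refine h (if_pos ⟨x, y, lt_of_le_of_ne (hQ.1.1 _) (Ne.symm hne), hxy⟩)

theorem continuous_ent {α : Type*} [Fintype α] : Continuous (ent : (α → ℝ) → ℝ) := by
  unfold ent
  exact continuous_finsetSum _ fun a _ => Real.continuous_negMulLog.comp (continuous_apply a)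

theorem continuous_llr (W : X → Y → ℝ) : Continuous (llr W) := by
  unfold llr
  fun_prop

theorem continuous_divR (P : X → ℝ) (W : X → Y → ℝ) : Continuous (divR P W) := by
  unfold divR
  exact (continuous_const.sub continuous_ent).sub (continuous_llr W)

theorem continuous_margX : Continuous (margX : (X × Y → ℝ) → X → ℝ) := by
  unfold margX
  fun_prop

theorem continuous_margY : Continuous (margY : (X × Y → ℝ) → Y → ℝ) := by
  unfold margY
  fun_prop

/-! ### Linearity, convexity and compactness -/

theorem llr_add (W : X → Y → ℝ) (Q Q' : X × Y → ℝ) : llr W (Q + Q') = llr W Q + llr W Q' := by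
  simp [llr, add_mul, Finset.sum_add_distrib]

theorem llr_smul (W : X → Y → ℝ) (c : ℝ) (Q : X × Y → ℝ) : llr W (c • Q) = c * llr W Q := by
  simp [llr, Finset.mul_sum, mul_assoc]

theorem margX_add (Q Q' : X × Y → ℝ) : margX (Q + Q') = margX Q + margX Q' := by
  ext; simp [margX, Finset.sum_add_distrib]

theorem margX_smul (c : ℝ) (Q : X × Y → ℝ) : margX (c • Q) = c • margX Q := by
  ext; simp [margX, Finset.mul_sum]

theorem margY_add (Q Q' : X × Y → ℝ) : margY (Q + Q') = margY Q + margY Q' := by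
  ext; simp [margY, Finset.sum_add_distrib]

theorem margY_smul (c : ℝ) (Q : X × Y → ℝ) : margY (c • Q) = c • margY Q := by
  ext; simp [margY, Finset.mul_sum]

theorem convex_jointDist : Convex ℝ (jointDist P : Set (X × Y → ℝ)) := by
  intro Q hQ Q' hQ' a b ha hb hab
  refine ⟨convex_stdSimplex ℝ _ hQ.1 hQ'.1 ha hb hab, ?_⟩
  rw [margX_add, margX_smul, margX_smul, hQ.2, hQ'.2, ← add_smul, hab, one_smul]

theorem convex_admissible : Convex ℝ (admissible P W) := by
  intro Q hQ Q' hQ' a b ha hb hab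
  refine ⟨convex_jointDist hQ.1 hQ'.1 ha hb hab, fun x y h => ?_⟩
  simp [hQ.2 x y h, hQ'.2 x y h]

theorem isCompact_admissible : IsCompact (admissible P W) := by
  refine (isCompact_stdSimplex ℝ (X × Y)).of_isClosed_subset ?_ fun Q hQ => hQ.1.1
  have : admissible P W = (stdSimplex ℝ (X × Y) ∩ {Q | margX Q = P}) ∩
      ⋂ x, ⋂ y, ⋂ _ : W x y = 0, {Q | Q (x, y) = 0} := by
    ext Q
    simp [admissible, jointDist]
  rw [this]
  refine ((isClosed_stdSimplex ℝ _).inter (isClosed_eq continuous_margX continuous_const)).inter ?_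
  exact isClosed_iInter fun x => isClosed_iInter fun y => isClosed_iInter fun _ =>
    isClosed_eq (continuous_apply _) continuous_const

theorem strictConcaveOn_ent {α : Type*} [Fintype α] :
    StrictConcaveOn ℝ {p : α → ℝ | ∀ a, 0 ≤ p a} ent := by
  refine ⟨fun p hp q hq a b ha hb _ i => ?_, fun p hp q hq hpq a b ha hb hab => ?_⟩
  · simp only [Pi.add_apply, Pi.smul_apply, smul_eq_mul]
    exact add_nonneg (mul_nonneg ha (hp i)) (mul_nonneg hb (hq i))
  · obtain ⟨i, hi⟩ := Function.ne_iff.1 hpq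
    unfold ent
    rw [smul_eq_mul, smul_eq_mul, Finset.mul_sum, Finset.mul_sum, ← Finset.sum_add_distrib]
    refine Finset.sum_lt_sum (fun j _ => ?_) ⟨i, Finset.mem_univ i, ?_⟩
    · exact Real.concaveOn_negMulLog.2 (hp j) (hq j) ha.le hb.le hab
    · exact Real.strictConcaveOn_negMulLog.2 (hp i) (hq i) hi ha hb hab

/-- With the `X`-marginal fixed, the divergence is the negative joint entropy plus an affine
function. -/
theorem strictConvexOn_divR : StrictConvexOn ℝ (admissible P W) (divR P W) := by
  refine ⟨convex_admissible, fun Q hQ Q' hQ' hne a b ha hb hab => ?_⟩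
  have := strictConcaveOn_ent.2 (x := Q) hQ.1.1.1 (y := Q') hQ'.1.1.1 hne ha hb hab
  simp only [divR, llr_add, llr_smul, smul_eq_mul] at this ⊢
  have h1 : ent P = a * ent P + b * ent P := by rw [← add_mul, hab, one_mul]
  linarith

/-- The joint input-output distribution of the channel. -/
def channelDist (P : X → ℝ) (W : X → Y → ℝ) : X × Y → ℝ := fun a => P a.1 * W a.1 a.2

theorem channelDist_mem (hP : P ∈ stdSimplex ℝ X) (hW : ∀ x, W x ∈ stdSimplex ℝ Y) :
    channelDist P W ∈ admissible P W := by
  have hm : margX (channelDist P W) = P := by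
    ext x; simp [margX, channelDist, ← Finset.mul_sum, (hW x).2]
  refine ⟨⟨⟨fun a => mul_nonneg (hP.1 _) ((hW _).1 _), ?_⟩, hm⟩, fun x y h => by
    simp [channelDist, h]⟩
  rw [sum_eq_sum_margX, hm, hP.2]

theorem divR_channelDist (hW : ∀ x, W x ∈ stdSimplex ℝ Y) :
    divR P W (channelDist P W) = 0 := by
  have h : ent (channelDist P W) = ent P - llr W (channelDist P W) := by
    unfold ent llr channelDist
    rw [Fintype.sum_prod_type, ← Finset.sum_sub_distrib]
    refine Finset.sum_congr rfl fun x _ => ?_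
    simp only [Real.negMulLog_mul, Finset.sum_add_distrib]
    rw [← Finset.sum_mul, (hW x).2, one_mul, sub_eq_add_neg, ← Finset.sum_neg_distrib]
    congr 1
    refine Finset.sum_congr rfl fun y _ => ?_
    simp [Real.negMulLog]; ring
  unfold divR
  rw [h]; ring

/-- The log-sum inequality. Each term is bounded by `log z ≤ z - 1`; the linear corrections add up
to `-(a + c) + (b + d) * ((a + c) / (b + d)) = 0`. -/
theorem log_sum_two {a b c d : ℝ} (ha : 0 ≤ a) (hc : 0 ≤ c) (hb : 0 ≤ b) (hd : 0 ≤ d)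
    (hab : b = 0 → a = 0) (hcd : d = 0 → c = 0) :
    (a + c) * Real.log ((a + c) / (b + d)) ≤ a * Real.log (a / b) + c * Real.log (c / d) := by
  have key : ∀ u v s t : ℝ, 0 ≤ u → 0 ≤ v → (v = 0 → u = 0) → 0 < s → 0 < t →
      u * Real.log (s / t) ≤ u * Real.log (u / v) - u + v * (s / t) := by
    intro u v s t hu hv huv hs ht
    rcases hu.eq_or_lt with rfl | hu
    · simp; positivity
    · have hv : 0 < v := lt_of_le_of_ne hv fun h => hu.ne' (huv h.symm)
      have h := Real.log_le_sub_one_of_pos (x := (s / t) / (u / v)) (by positivity)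
      rw [Real.log_div (by positivity) (by positivity)] at h
      have h2 := mul_le_mul_of_nonneg_left h hu.le
      have h3 : u * (s / t / (u / v) - 1) = v * (s / t) - u := by field_simp
      nlinarith
  rcases (add_nonneg ha hc).eq_or_lt with h | h
  · have h1 : a = 0 := by linarith
    have h2 : c = 0 := by linarith
    simp [h1, h2]
  · have hbd : 0 < b + d := by
      rcases (add_nonneg hb hd).eq_or_lt with h' | h'
      · have h1 : b = 0 := by linarith
        have h2 : d = 0 := by linarith
        rw [hab h1, hcd h2] at h; simp at h
      · exact h'
    have h1 := key a b (a + c) (b + d) ha hb hab h hbd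
    have h2 := key c d (a + c) (b + d) hc hd hcd h hbd
    have h3 : b * ((a + c) / (b + d)) + d * ((a + c) / (b + d)) = a + c := by field_simp
    nlinarith

/-- Mixing with a product distribution of the same `X`-marginal scales the mutual information
down. -/
theorem mutualInfo_mix_prod_le (hP : P ∈ stdSimplex ℝ X) (hQ : Q ∈ jointDist P) {r : Y → ℝ}
    (hr : r ∈ stdSimplex ℝ Y) {t : ℝ} (h0 : 0 ≤ t) (h1 : t ≤ 1) :
    mutualInfo ((1 - t) • Q + t • fun a : X × Y => P a.1 * r a.2) ≤ (1 - t) * mutualInfo Q := by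
  have hQ0 := hQ.1.1
  have h1t : 0 ≤ 1 - t := by linarith
  have hmX : margX (fun a : X × Y => P a.1 * r a.2) = P := by
    ext x; simp [margX, ← Finset.mul_sum, hr.2]
  have hmY : margY (fun a : X × Y => P a.1 * r a.2) = r := by
    ext x; simp [margY, ← Finset.sum_mul, hP.2]
  unfold mutualInfo
  rw [Finset.mul_sum]
  refine Finset.sum_le_sum fun x _ => ?_
  rw [Finset.mul_sum]
  refine Finset.sum_le_sum fun y _ => ?_
  rw [margX_add, margX_smul, margX_smul, hmX, hQ.2, margY_add, margY_smul, margY_smul, hmY]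
  have hp := hP.1 x
  have hq : 0 ≤ margY Q y := margY_nonneg hQ0 y
  have hx : margX Q x = P x := by rw [hQ.2]
  have hrd := hr.1 y
  -- The log-sum inequality is applied cell by cell. In the product part numerator and denominator
  -- coincide, so its logarithm vanishes (`e1`) and only the part from `Q` remains.
  have := log_sum_two (a := (1 - t) * Q (x, y)) (b := (1 - t) * (P x * margY Q y))
    (c := t * (P x * r y)) (d := t * (P x * r y)) (mul_nonneg h1t (hQ0 _)) (by positivity)
    (by positivity) (by positivity) (by
      intro h
      rcases mul_eq_zero.1 h with h | h
      · rw [h, zero_mul]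
      · rcases mul_eq_zero.1 h with h | h
        · have := le_margX hQ0 x y
          rw [hx, h] at this
          rw [le_antisymm this (hQ0 _), mul_zero]
        · have := le_margY hQ0 x y
          rw [h] at this
          rw [le_antisymm this (hQ0 _), mul_zero]) (fun h => h)
  have e1 : t * (P x * r y) * Real.log (t * (P x * r y) / (t * (P x * r y))) = 0 := by
    rcases eq_or_ne (t * (P x * r y)) 0 with h | h
    · rw [h, zero_mul]
    · rw [div_self h, Real.log_one, mul_zero]
  rw [e1, add_zero] at this
  have e2 : (1 - t) * Q (x, y) * Real.log ((1 - t) * Q (x, y) / ((1 - t) * (P x * margY Q y))) =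
      (1 - t) * (Q (x, y) * Real.log (Q (x, y) / (P x * margY Q y))) := by
    rcases eq_or_ne (1 - t) 0 with h | h
    · simp [h]
    · rw [mul_div_mul_left _ _ h]; ring
  rw [e2] at this
  have e3 : (1 - t) * (P x * margY Q y) + t * (P x * r y) =
      ((1 - t) * P x + t * P x) * ((1 - t) * margY Q y + t * r y) := by ring
  rw [e3] at this
  exact this

end Info

/-! ### The optimal output threshold -/

section Threshold

open Topology

variable {X Y : Type*} [Fintype X] [Fintype Y] {P : X → ℝ} {W : X → Y → ℝ} {E : ℝ}

/-- The admissible joint distributions of conditional divergence at most `E`. -/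
def divBall (P : X → ℝ) (W : X → Y → ℝ) (E : ℝ) : Set (X × Y → ℝ) :=
  {Q | Q ∈ admissible P W ∧ divR P W Q ≤ E}

theorem isCompact_divBall : IsCompact (divBall P W E) :=
  isCompact_admissible.inter_right (isClosed_le (continuous_divR P W) continuous_const)

theorem mem_divBall_iff {Q : X × Y → ℝ} :
    Q ∈ divBall P W E ↔ Q ∈ jointDist P ∧ condDiv W Q ≤ (E : EReal) := by
  constructor
  · rintro ⟨h1, h2⟩
    exact ⟨h1.1, by rw [condDiv_eq_coe h1]; exact_mod_cast h2⟩
  · rintro ⟨h1, h2⟩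
    have h3 := admissible_of_condDiv_ne_top h1 (ne_top_of_le_ne_top (EReal.coe_ne_top E) h2)
    rw [condDiv_eq_coe h3] at h2
    exact ⟨h3, by exact_mod_cast h2⟩

theorem optimalOutputThreshold_le (hW : ∀ x, W x ∈ stdSimplex ℝ Y) {Q : X × Y → ℝ}
    (hQ : Q ∈ divBall P W E) : optimalOutputThreshold P W E (margY Q) ≤ (llr W Q : EReal) := by
  have h := mem_divBall_iff.1 hQ
  exact sInf_le ⟨Q, h.1, rfl, h.2, (logLik_eq_coe hW hQ.1.2).symm⟩

theorem optimalOutputThreshold_eq_top {q : Y → ℝ} (hq : q ∉ margY '' divBall P W E) :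
    optimalOutputThreshold P W E q = ⊤ := by
  unfold optimalOutputThreshold
  rw [sInf_eq_top]
  rintro v ⟨Q, h1, h2, h3, -⟩
  exact absurd ⟨Q, mem_divBall_iff.2 ⟨h1, h3⟩, h2⟩ hq

theorem exists_optimalOutputThreshold_eq (hW : ∀ x, W x ∈ stdSimplex ℝ Y) {q : Y → ℝ}
    (hq : q ∈ margY '' divBall P W E) :
    ∃ Q ∈ divBall P W E, margY Q = q ∧ optimalOutputThreshold P W E q = (llr W Q : EReal) := by
  have hc : IsCompact (divBall P W E ∩ {Q | margY Q = q}) :=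
    isCompact_divBall.inter_right (isClosed_eq continuous_margY continuous_const)
  obtain ⟨Q0, hQ0, hQq⟩ := hq
  obtain ⟨Q, hQ, hmin⟩ := hc.exists_isMinOn ⟨Q0, hQ0, hQq⟩ (continuous_llr W).continuousOn
  refine ⟨Q, hQ.1, hQ.2, le_antisymm ?_ (le_sInf ?_)⟩
  · have := optimalOutputThreshold_le hW hQ.1
    rwa [show margY Q = q from hQ.2] at this
  · rintro v ⟨Q', h1, h2, h3, rfl⟩
    have h4 : Q' ∈ divBall P W E := mem_divBall_iff.2 ⟨h1, h3⟩
    rw [logLik_eq_coe hW h4.1.2]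
    exact_mod_cast hmin ⟨h4, h2⟩

/-- Limits of minimizers of the log-likelihood over the fibres of the `Y`-marginal are
minimizers. -/
theorem llr_le_of_tendsto_minimizers {Q : ℕ → X × Y → ℝ} {L Q' : X × Y → ℝ}
    (hQ : ∀ k, Q k ∈ divBall P W E)
    (hmin : ∀ k, ∀ R ∈ divBall P W E, margY R = margY (Q k) → llr W (Q k) ≤ llr W R)
    (hL : Tendsto Q atTop (𝓝 L)) (hQ' : Q' ∈ divBall P W E) (hm : margY Q' = margY L) :
    llr W L ≤ llr W Q' := by
  by_contra! hlt
  have hLK : L ∈ divBall P W E :=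
    isCompact_divBall.isClosed.mem_of_tendsto hL (Eventually.of_forall hQ)
  have hne : Q' ≠ L := by rintro rfl; exact lt_irrefl _ hlt
  -- By strict convexity the midpoint satisfies the divergence constraint strictly, and it still has
  -- a smaller likelihood than `L`.
  set A : X × Y → ℝ := (1 / 2 : ℝ) • Q' + (1 / 2 : ℝ) • L with hA
  have hAadm : A ∈ admissible P W :=
    convex_admissible hQ'.1 hLK.1 (by norm_num) (by norm_num) (by norm_num)
  have hAdiv : divR P W A < E := by
    have := (strictConvexOn_divR (P := P) (W := W)).2 hQ'.1 hLK.1 hne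
      (show (0 : ℝ) < 1 / 2 by norm_num) (show (0 : ℝ) < 1 / 2 by norm_num) (by norm_num)
    have h1 := hQ'.2
    have h2 := hLK.2
    simp only [smul_eq_mul] at this
    rw [← hA] at this
    linarith
  have hAllr : llr W A < llr W L := by
    rw [hA, llr_add, llr_smul, llr_smul]; linarith
  have hAm : margY A = margY L := by
    rw [hA, margY_add, margY_smul, margY_smul, hm, ← add_smul]; norm_num
  -- Translating the midpoint by `Q k - L` moves it into the fibre of `Q k`, where it will beat the
  -- minimizer `Q k`.
  set B : ℕ → X × Y → ℝ := fun k => A + (Q k + (-1 : ℝ) • L) with hB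
  have hBt : Tendsto B atTop (𝓝 A) := by
    have : Tendsto B atTop (𝓝 (A + (L + (-1 : ℝ) • L))) :=
      tendsto_const_nhds.add (hL.add tendsto_const_nhds)
    simpa using this
  -- Where `L` vanishes, `B k` is a sum of nonnegative terms; where `L` is positive, so is the
  -- midpoint, and `B k` converges to it.
  have hnn : ∀ a, ∀ᶠ k in atTop, 0 ≤ B k a := by
    intro a
    have hQ'a := hQ'.1.1.1.1 a
    rcases (hLK.1.1.1.1 a).eq_or_lt with h | h
    · refine Eventually.of_forall fun k => ?_
      have := (hQ k).1.1.1.1 a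
      simp only [hB, hA, Pi.add_apply, Pi.smul_apply, smul_eq_mul, ← h]
      linarith
    · have hAa : 0 < A a := by
        simp only [hA, Pi.add_apply, Pi.smul_apply, smul_eq_mul]
        linarith
      exact ((tendsto_pi_nhds.1 hBt a).eventually (lt_mem_nhds hAa)).mono fun k hk => hk.le
  have h1 : ∀ᶠ k in atTop, divR P W (B k) < E :=
    (((continuous_divR P W).tendsto A).comp hBt).eventually (gt_mem_nhds hAdiv)
  have h2 : ∀ᶠ k in atTop, llr W (B k) < llr W (Q k) :=
    ((((continuous_llr W).tendsto A).comp hBt).eventually_lt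
      (((continuous_llr W).tendsto L).comp hL) hAllr)
  obtain ⟨k, hk1, hk2, hk3⟩ := (h1.and (h2.and (eventually_all.2 hnn))).exists
  have hmX : margX (B k) = P := by
    simp only [hB, margX_add, margX_smul, hAadm.1.2, (hQ k).1.1.2, hLK.1.1.2]
    simp
  have hBadm : B k ∈ admissible P W := by
    refine ⟨⟨⟨hk3, ?_⟩, hmX⟩, fun x y hxy => ?_⟩
    · rw [sum_eq_sum_margX, hmX, ← hLK.1.1.2, ← sum_eq_sum_margX]
      exact hLK.1.1.1.2
    · simp [hB, hAadm.2 x y hxy, (hQ k).1.2 x y hxy, hLK.1.2 x y hxy]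
  have hmY : margY (B k) = margY (Q k) := by
    simp only [hB, margY_add, margY_smul, hAm]
    simp
  exact absurd (hmin k (B k) ⟨hBadm, hk1.le⟩ hmY) (not_le.2 hk2)

/-- The compact set is the image of the divergence ball. For continuity, minimizers over a
convergent sequence of marginals have a convergent subsequence, and its limit is again a minimizer.
-/
theorem isThreshold_optimalOutputThreshold (hW : ∀ x, W x ∈ stdSimplex ℝ Y) :
    IsThreshold (optimalOutputThreshold P W E) := by
  refine ⟨margY '' divBall P W E, ?_, isCompact_divBall.image continuous_margY, ?_, ?_,
    fun q hq => optimalOutputThreshold_eq_top hq⟩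
  · rintro _ ⟨Q, hQ, rfl⟩
    exact margY_mem_stdSimplex hQ.1.1.1
  · choose! m hm1 hm2 hm3 using
      fun q (hq : q ∈ margY '' divBall P W E) => exists_optimalOutputThreshold_eq hW hq
    have hmin : ∀ q ∈ margY '' divBall P W E, ∀ R ∈ divBall P W E, margY R = margY (m q) →
        llr W (m q) ≤ llr W R := by
      intro q hq R hR hRq
      have := optimalOutputThreshold_le hW hR
      rw [hRq, hm2 q hq, hm3 q hq] at this
      exact_mod_cast this
    rw [continuousOn_iff_continuous_domRestrict, continuous_iff_seqContinuous]
    intro u q hu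
    have hu' : Tendsto (fun k => (u k : Y → ℝ)) atTop (𝓝 (q : Y → ℝ)) :=
      (continuous_subtype_val.tendsto q).comp hu
    refine tendsto_of_subseq_tendsto fun ns hns => ?_
    obtain ⟨L, hL, φ, hφ, hlim⟩ := isCompact_divBall.tendsto_subseq
      (x := fun k => m (u (ns k))) fun k => hm1 _ (u (ns k)).2
    refine ⟨φ, ?_⟩
    have hLq : margY L = q := by
      refine tendsto_nhds_unique ((continuous_margY.tendsto L).comp hlim) ?_
      have : (margY ∘ (fun k => m (u (ns k))) ∘ φ) = fun k => (u (ns (φ k)) : Y → ℝ) := by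
        ext1 k; exact hm2 _ (u (ns (φ k))).2
      rw [this]
      exact hu'.comp (hns.comp hφ.tendsto_atTop)
    have hle := llr_le_of_tendsto_minimizers (fun k => hm1 _ (u (ns (φ k))).2)
      (fun k => hmin _ (u (ns (φ k))).2) hlim (hm1 q q.2) ((hm2 q q.2).trans hLq.symm)
    have hge := hmin q q.2 L hL (hLq.trans (hm2 q q.2).symm)
    have heq : llr W L = llr W (m q) := le_antisymm hle hge
    have h1 : Tendsto (fun k => (llr W (m (u (ns (φ k)))) : EReal)) atTop
        (𝓝 (llr W (m q) : EReal)) := by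
      rw [← heq]
      exact (continuous_coe_real_ereal.tendsto _).comp (((continuous_llr W).tendsto L).comp hlim)
    rw [Set.domRestrict_apply, hm3 q q.2]
    exact h1.congr fun k => (hm3 _ (u (ns (φ k))).2).symm
  · intro q hq
    obtain ⟨Q, -, -, h⟩ := exists_optimalOutputThreshold_eq hW hq
    rw [h]
    exact ⟨EReal.coe_ne_bot _, EReal.coe_ne_top _⟩

end Threshold

/-! ### Cardinalities of type classes -/

section TypeClass

variable {α : Type*} [Fintype α] [DecidableEq α] {n : ℕ}

/-- The number of occurrences of a letter in a vector. -/
def letterCount (x : Fin n → α) (a : α) : ℕ := (Finset.univ.filter fun i => x i = a).card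

theorem sum_letterCount (x : Fin n → α) : ∑ a, letterCount x a = n := by
  have := Finset.card_eq_sum_card_fiberwise (f := x) (s := Finset.univ) (t := Finset.univ)
    (fun _ _ => Finset.mem_univ _)
  simpa [letterCount] using this.symm

theorem empDist_apply (x : Fin n → α) (a : α) : empDist x a = (letterCount x a : ℝ) / n := rfl

theorem sum_comp_eq (hn : 0 < n) (x : Fin n → α) (F : α → ℝ) :
    ∑ i, F (x i) = n * ∑ a, empDist x a * F a := by
  have hn' : (n : ℝ) ≠ 0 := by positivity
  rw [Finset.mul_sum, ← Finset.sum_fiberwise (s := Finset.univ) (g := x)]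
  refine Finset.sum_congr rfl fun a _ => ?_
  rw [Finset.sum_congr rfl (g := fun _ => F a) fun i hi => by rw [(Finset.mem_filter.1 hi).2],
    Finset.sum_const, nsmul_eq_mul, empDist_apply, letterCount]
  field_simp

theorem empDist_nonneg (x : Fin n → α) (a : α) : 0 ≤ empDist x a := by
  rw [empDist_apply]; positivity

theorem empDist_mem_stdSimplex (hn : 0 < n) (x : Fin n → α) : empDist x ∈ stdSimplex ℝ α := by
  refine ⟨empDist_nonneg x, ?_⟩
  have hn' : (n : ℝ) ≠ 0 := by positivity
  simp only [empDist_apply, ← Finset.sum_div]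
  rw [← Nat.cast_sum, sum_letterCount, div_self hn']

theorem empDist_comp_perm (x : Fin n → α) (σ : Equiv.Perm (Fin n)) :
    empDist (x ∘ σ) = empDist x := by
  ext a
  simp only [empDist]
  congr 2
  exact Finset.card_bij (fun i _ => σ i) (by simp) (by simp)
    (fun b hb => ⟨σ.symm b, by simpa using hb, by simp⟩)

theorem letterCount_eq_of_empDist_eq {x x' : Fin n → α} (h : empDist x = empDist x') :
    letterCount x = letterCount x' := by
  ext a
  rcases Nat.eq_zero_or_pos n with rfl | hn
  · simp [letterCount]
  · have hn' : (n : ℝ) ≠ 0 := by positivity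
    have := congrFun h a
    rw [empDist_apply, empDist_apply, div_left_inj' hn'] at this
    exact_mod_cast this

theorem exists_perm_of_empDist_eq {x x' : Fin n → α} (h : empDist x = empDist x') :
    ∃ σ : Equiv.Perm (Fin n), x ∘ σ = x' := by
  have hc := letterCount_eq_of_empDist_eq h
  have e : ∀ a, Nonempty ({i // x' i = a} ≃ {i // x i = a}) := by
    intro a
    refine ⟨Fintype.equivOfCardEq ?_⟩
    rw [Fintype.card_subtype, Fintype.card_subtype]
    exact (congrFun hc a).symm
  refine ⟨Equiv.ofFiberEquiv fun a => (e a).some, ?_⟩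
  ext1 i
  exact Equiv.ofFiberEquiv_map _ i

theorem mem_typeClass {p : α → ℝ} {x : Fin n → α} : x ∈ typeClass p n ↔ empDist x = p := by
  simp [typeClass]

/-- Orbit counting: permutations act transitively on a type class, and each fibre of `σ ↦ x ∘ σ` is
a translate of the stabilizer of `x`, which has `∏ (letterCount x a)!` elements. -/
theorem card_typeClass_mul (x : Fin n → α) :
    (typeClass (empDist x) n).card * ∏ a, (letterCount x a).factorial = n.factorial := by
  classical
  have h1 : (Finset.univ : Finset (Equiv.Perm (Fin n))).card =
      ∑ x' ∈ typeClass (empDist x) n,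
        (Finset.univ.filter fun σ : Equiv.Perm (Fin n) => x ∘ σ = x').card :=
    Finset.card_eq_sum_card_fiberwise fun σ _ => mem_typeClass.2 (empDist_comp_perm x σ)
  have h2 : ∀ x' ∈ typeClass (empDist x) n,
      (Finset.univ.filter fun σ : Equiv.Perm (Fin n) => x ∘ σ = x').card =
        ∏ a, (letterCount x a).factorial := by
    intro x' hx'
    obtain ⟨τ, hτ⟩ := exists_perm_of_empDist_eq (mem_typeClass.1 hx').symm
    have h3 := DomMulAct.stabilizer_card x
    simp only [Fintype.card_subtype] at h3
    simp only [letterCount]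
    rw [← h3]
    refine Finset.card_bij (fun σ _ => σ * τ⁻¹) ?_ (by simp) ?_
    · intro σ hσ
      simp only [Finset.mem_filter, Finset.mem_univ, true_and] at hσ ⊢
      ext1 i
      have := congrFun (hσ.trans hτ.symm) (τ⁻¹ i)
      simpa using this
    · intro g hg
      simp only [Finset.mem_filter, Finset.mem_univ, true_and] at hg
      refine ⟨g * τ, ?_, by simp⟩
      simp only [Finset.mem_filter, Finset.mem_univ, true_and]
      rw [← hτ, Equiv.Perm.coe_mul, ← Function.comp_assoc, hg]
  rw [Finset.sum_congr rfl h2, Finset.sum_const, smul_eq_mul, Finset.card_univ,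
    Fintype.card_perm, Fintype.card_fin] at h1
  exact h1.symm

theorem le_log_factorial (k : ℕ) : (k : ℝ) * Real.log k - k ≤ Real.log k.factorial := by
  rcases Nat.eq_zero_or_pos k with rfl | hk
  · simp
  · have hk' : (0 : ℝ) < k := by exact_mod_cast hk
    have h := Real.pow_div_factorial_le_exp (k : ℝ) hk'.le k
    have hf : (0 : ℝ) < k.factorial := by exact_mod_cast k.factorial_pos
    have := Real.log_le_log (by positivity) h
    rw [Real.log_div (by positivity) hf.ne', Real.log_pow, Real.log_exp] at this
    linarith

/-- A weak Stirling bound; the induction step uses `log (k / (k + 1)) ≤ -1 / (k + 1)`. -/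
theorem log_factorial_le_of_pos (k : ℕ) (hk : 1 ≤ k) :
    Real.log k.factorial ≤ (k : ℝ) * Real.log k - k + 1 + Real.log k := by
  induction k, hk using Nat.le_induction with
  | base => simp
  | succ k hk ih =>
    have hk' : (0 : ℝ) < k := by exact_mod_cast hk
    have hf : (0 : ℝ) < k.factorial := by exact_mod_cast k.factorial_pos
    rw [Nat.factorial_succ, Nat.cast_mul, Real.log_mul (by positivity) hf.ne']
    have h := Real.log_le_sub_one_of_pos (x := (k : ℝ) / (k + 1)) (by positivity)
    rw [Real.log_div (by positivity) (by positivity)] at h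
    have h2 := mul_le_mul_of_nonneg_left h (show (0 : ℝ) ≤ k + 1 by positivity)
    have h3 : ((k : ℝ) + 1) * (k / (k + 1) - 1) = -1 := by field_simp; ring
    push_cast
    nlinarith

/-- The logarithm of the polynomial factors of the method of types. -/
def polyLog (n : ℕ) : ℝ := 1 + Real.log (n + 1)

theorem polyLog_nonneg (n : ℕ) : 0 ≤ polyLog n := by
  have : 0 ≤ Real.log ((n : ℝ) + 1) := Real.log_nonneg (by linarith [n.cast_nonneg (α := ℝ)])
  unfold polyLog; linarith

theorem polyLog_mono {k n : ℕ} (h : k ≤ n) : polyLog k ≤ polyLog n := by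
  have : (k : ℝ) ≤ n := by exact_mod_cast h
  have := Real.log_le_log (by positivity : (0 : ℝ) < k + 1) (by linarith : (k : ℝ) + 1 ≤ n + 1)
  unfold polyLog; linarith

theorem log_factorial_le (k : ℕ) :
    Real.log k.factorial ≤ (k : ℝ) * Real.log k - k + polyLog k := by
  rcases Nat.eq_zero_or_pos k with rfl | hk
  · simp [polyLog]
  · have h := log_factorial_le_of_pos k hk
    have hk' : (0 : ℝ) < k := by exact_mod_cast hk
    have := Real.log_le_log hk' (by linarith : (k : ℝ) ≤ k + 1)
    unfold polyLog
    linarith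

theorem mul_ent_empDist (hn : 0 < n) (x : Fin n → α) :
    n * ent (empDist x) =
      n * Real.log n - ∑ a, (letterCount x a : ℝ) * Real.log (letterCount x a) := by
  have hn' : (n : ℝ) ≠ 0 := by positivity
  have h : ∀ a, n * Real.negMulLog (empDist x a) =
      letterCount x a * Real.log n - (letterCount x a : ℝ) * Real.log (letterCount x a) := by
    intro a
    rw [empDist_apply, Real.negMulLog]
    rcases eq_or_ne (letterCount x a : ℝ) 0 with h | h
    · simp [h]
    · rw [Real.log_div h hn']
      field_simp
      ring
  unfold ent
  rw [Finset.mul_sum, Finset.sum_congr rfl fun a _ => h a, Finset.sum_sub_distrib,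
    ← Finset.sum_mul, ← Nat.cast_sum, sum_letterCount]

theorem log_card_typeClass (x : Fin n → α) :
    Real.log (typeClass (empDist x) n).card =
      Real.log n.factorial - ∑ a, Real.log (letterCount x a).factorial := by
  have h := card_typeClass_mul x
  have hc : (typeClass (empDist x) n).card ≠ 0 := by
    rintro h0; rw [h0, zero_mul] at h; exact n.factorial_ne_zero h.symm
  have h' := congrArg (fun k : ℕ => Real.log k) h
  simp only [Nat.cast_mul, Nat.cast_prod] at h'
  rw [Real.log_mul (by exact_mod_cast hc)
    (Finset.prod_ne_zero_iff.2 fun a _ => by exact_mod_cast Nat.factorial_ne_zero _),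
    Real.log_prod fun a _ => by exact_mod_cast Nat.factorial_ne_zero _] at h'
  linarith

theorem card_typeClass_pos (x : Fin n → α) : 0 < (typeClass (empDist x) n).card :=
  Finset.card_pos.2 ⟨x, mem_typeClass.2 rfl⟩

/-- Stirling bounds in the multinomial coefficient. The linear terms cancel because the letter
counts add up to `n`. -/
theorem card_typeClass_le (hn : 0 < n) (x : Fin n → α) :
    ((typeClass (empDist x) n).card : ℝ) ≤ Real.exp (n * ent (empDist x) + polyLog n) := by
  rw [← Real.log_le_iff_le_exp (by exact_mod_cast card_typeClass_pos x), log_card_typeClass,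
    mul_ent_empDist hn]
  have h1 := log_factorial_le n
  have h2 := Finset.sum_le_sum fun a (_ : a ∈ Finset.univ) => le_log_factorial (letterCount x a)
  rw [Finset.sum_sub_distrib, ← Nat.cast_sum, sum_letterCount] at h2
  linarith

/-- Each of the `Fintype.card α` factorials in the denominator costs one `polyLog n`. -/
theorem le_card_typeClass (hn : 0 < n) (x : Fin n → α) :
    Real.exp (n * ent (empDist x) - Fintype.card α * polyLog n) ≤
      (typeClass (empDist x) n).card := by
  rw [← Real.le_log_iff_exp_le (by exact_mod_cast card_typeClass_pos x), log_card_typeClass,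
    mul_ent_empDist hn]
  have h1 := le_log_factorial n
  have h2 := Finset.sum_le_sum fun a (_ : a ∈ Finset.univ) =>
    (log_factorial_le (letterCount x a)).trans (add_le_add le_rfl (polyLog_mono
      ((Finset.single_le_sum (fun _ _ => Nat.zero_le _) (Finset.mem_univ a)).trans_eq
        (sum_letterCount x))))
  rw [Finset.sum_add_distrib, Finset.sum_sub_distrib, ← Nat.cast_sum, sum_letterCount,
    Finset.sum_const, nsmul_eq_mul, Finset.card_univ] at h2
  linarith

open Classical in
theorem card_image_empDist_le (n : ℕ) :
    (((Finset.univ : Finset (Fin n → α)).image empDist).card : ℝ) ≤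
      Real.exp (Fintype.card α * polyLog n) := by
  have h : ((Finset.univ : Finset (Fin n → α)).image empDist).card ≤
      Fintype.card (α → Fin (n + 1)) := by
    refine (Finset.card_le_card (t := (Finset.univ : Finset (α → Fin (n + 1))).image
      fun k a => ((k a : ℕ) : ℝ) / n) ?_).trans (Finset.card_image_le.trans_eq Finset.card_univ)
    intro p hp
    obtain ⟨x, -, rfl⟩ := Finset.mem_image.1 hp
    refine Finset.mem_image.2 ⟨fun a => ⟨letterCount x a, Nat.lt_succ_of_le
      ((Finset.single_le_sum (fun _ _ => Nat.zero_le _) (Finset.mem_univ a)).trans_eq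
        (sum_letterCount x))⟩, Finset.mem_univ _, ?_⟩
    ext a
    rfl
  rw [Fintype.card_fun, Fintype.card_fin] at h
  have h2 : ((n : ℝ) + 1) ≤ Real.exp (polyLog n) := by
    unfold polyLog
    rw [Real.exp_add, Real.exp_log (by positivity)]
    have := Real.add_one_le_exp (1 : ℝ)
    nlinarith [n.cast_nonneg (α := ℝ)]
  calc _ ≤ (((n + 1) ^ Fintype.card α : ℕ) : ℝ) := by exact_mod_cast h
    _ = ((n : ℝ) + 1) ^ Fintype.card α := by push_cast; rfl
    _ ≤ Real.exp (polyLog n) ^ Fintype.card α := pow_le_pow_left₀ (by positivity) h2 _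
    _ = _ := by rw [← Real.exp_nat_mul]

theorem exists_empDist_eq (k : α → ℕ) {N : ℕ} (hk : ∑ a, k a = N) :
    ∃ x : Fin N → α, ∀ a, empDist x a = (k a : ℝ) / N := by
  have e : Nonempty (Fin N ≃ Σ a, Fin (k a)) := by
    refine ⟨Fintype.equivOfCardEq ?_⟩
    simp [hk]
  refine ⟨fun i => (e.some i).1, fun a => ?_⟩
  simp only [empDist]
  congr 2
  have : ((Finset.univ : Finset (Σ a, Fin (k a))).filter fun s => s.1 = a).card = k a := by
    rw [← Fintype.card_subtype]
    exact (Fintype.card_congr (Equiv.sigmaSubtype a)).trans (Fintype.card_fin _)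
  rw [← this]
  exact Finset.card_bij (fun i _ => e.some i) (by simp) (by simp)
    (fun b hb => ⟨e.some.symm b, by simpa using hb, by simp⟩)

end TypeClass

/-! ### Probabilities of joint types -/

section JointType

variable {X Y : Type*} [Fintype X] [DecidableEq X] [Fintype Y] [DecidableEq Y]
  {P : X → ℝ} {W : X → Y → ℝ} {n : ℕ}

theorem margX_jointEmpDist (x : Fin n → X) (y : Fin n → Y) :
    margX (jointEmpDist x y) = empDist x := by
  ext a
  simp only [margX, jointEmpDist, empDist, ← Finset.sum_div]
  congr 1
  rw [← Nat.cast_sum, Finset.card_eq_sum_card_fiberwise (f := y)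
    (s := Finset.univ.filter fun i => x i = a) (t := Finset.univ) fun _ _ => Finset.mem_univ _]
  simp [Finset.filter_filter]

theorem margY_jointEmpDist (x : Fin n → X) (y : Fin n → Y) :
    margY (jointEmpDist x y) = empDist y := by
  ext b
  simp only [margY, jointEmpDist, empDist, ← Finset.sum_div]
  congr 1
  rw [← Nat.cast_sum, Finset.card_eq_sum_card_fiberwise (f := x)
    (s := Finset.univ.filter fun i => y i = b) (t := Finset.univ) fun _ _ => Finset.mem_univ _]
  simp [Finset.filter_filter, and_comm]

theorem jointEmpDist_mem_jointDist (hn : 0 < n) {x : Fin n → X} (hx : x ∈ typeClass P n)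
    (y : Fin n → Y) : jointEmpDist x y ∈ jointDist P :=
  ⟨empDist_mem_stdSimplex hn _, by rw [margX_jointEmpDist, mem_typeClass.1 hx]⟩

theorem jointEmpDist_comp_perm (x : Fin n → X) (y : Fin n → Y) (σ : Equiv.Perm (Fin n)) :
    jointEmpDist (x ∘ σ) (y ∘ σ) = jointEmpDist x y :=
  empDist_comp_perm (fun i => (x i, y i)) σ

theorem comp_perm_mem_typeClass {x : Fin n → X} (hx : x ∈ typeClass P n)
    (σ : Equiv.Perm (Fin n)) : x ∘ σ ∈ typeClass P n :=
  mem_typeClass.2 ((empDist_comp_perm x σ).trans (mem_typeClass.1 hx))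

theorem vecProb_nonneg (hW : ∀ x, W x ∈ stdSimplex ℝ Y) (x : Fin n → X) (y : Fin n → Y) :
    0 ≤ vecProb W x y :=
  Finset.prod_nonneg fun _ _ => (hW _).1 _

theorem sum_vecProb (hW : ∀ x, W x ∈ stdSimplex ℝ Y) (x : Fin n → X) :
    ∑ y, vecProb W x y = 1 := by
  have := Finset.prod_univ_sum (fun _ : Fin n => (Finset.univ : Finset Y)) fun i y => W (x i) y
  simp only [(hW _).2, Finset.prod_const_one, Fintype.piFinset_univ] at this
  exact this.symm

theorem jointEmpDist_ne_zero (hn : 0 < n) (x : Fin n → X) (y : Fin n → Y) (i : Fin n) :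
    jointEmpDist x y (x i, y i) ≠ 0 := by
  have hn' : (n : ℝ) ≠ 0 := by positivity
  refine div_ne_zero (Nat.cast_ne_zero.2 (Finset.card_ne_zero.2 ⟨i, by simp⟩)) hn'

theorem vecProb_eq_exp (hn : 0 < n) (hW : ∀ x, W x ∈ stdSimplex ℝ Y) {x : Fin n → X}
    {y : Fin n → Y} (h : ∀ a b, W a b = 0 → jointEmpDist x y (a, b) = 0) :
    vecProb W x y = Real.exp (n * llr W (jointEmpDist x y)) := by
  have h1 : n * llr W (jointEmpDist x y) = ∑ i, Real.log (W (x i) (y i)) := by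
    have := sum_comp_eq hn (fun i => (x i, y i)) fun a => Real.log (W a.1 a.2)
    rw [this, llr, Fintype.sum_prod_type]
    rfl
  rw [h1, Real.exp_sum]
  refine Finset.prod_congr rfl fun i _ => ?_
  rw [Real.exp_log (lt_of_le_of_ne ((hW _).1 _) fun h0 =>
    jointEmpDist_ne_zero hn x y i (h _ _ h0.symm))]

theorem supp_of_vecProb_ne_zero {x : Fin n → X} {y : Fin n → Y} (h : vecProb W x y ≠ 0)
    (a : X) (b : Y) (hab : W a b = 0) : jointEmpDist x y (a, b) = 0 := by
  have h' : ∀ i, W (x i) (y i) ≠ 0 := fun i => Finset.prod_ne_zero_iff.1 h i (Finset.mem_univ i)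
  unfold jointEmpDist empDist
  rw [Finset.card_eq_zero.2, Nat.cast_zero, zero_div]
  refine Finset.filter_eq_empty_iff.2 fun i _ hi => h' i ?_
  rw [Prod.mk.injEq] at hi
  rw [hi.1, hi.2, hab]

theorem card_typeClass_pos_of_mem {x : Fin n → X} (hx : x ∈ typeClass P n) :
    (0 : ℝ) < (typeClass P n).card := by
  exact_mod_cast Finset.card_pos.2 ⟨x, hx⟩

/-- A common constant for the polynomial factors. -/
def typeConst (X Y : Type*) [Fintype X] [Fintype Y] : ℝ :=
  2 * Fintype.card (X × Y) + Fintype.card X + Fintype.card Y + 2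

theorem card_filter_jointEmpDist (Q : X × Y → ℝ) (hQ : margX Q = P) :
    (((typeClass P n) ×ˢ (Finset.univ : Finset (Fin n → Y))).filter
      fun p => jointEmpDist p.1 p.2 = Q).card = (typeClass Q n).card := by
  refine Finset.card_bij (fun p _ i => (p.1 i, p.2 i)) ?_ ?_ ?_
  · intro p hp
    exact mem_typeClass.2 (Finset.mem_filter.1 hp).2
  · intro p _ p' _ h
    ext i
    · exact congrArg Prod.fst (congrFun h i)
    · exact congrArg Prod.snd (congrFun h i)
  · intro z hz
    have hz' : jointEmpDist (fun i => (z i).1) (fun i => (z i).2) = Q := mem_typeClass.1 hz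
    refine ⟨(fun i => (z i).1, fun i => (z i).2), ?_, rfl⟩
    simp only [Finset.mem_filter, Finset.mem_product, Finset.mem_univ, and_true]
    refine ⟨mem_typeClass.2 ?_, hz'⟩
    rw [← margX_jointEmpDist _ (fun i => (z i).2), hz', hQ]

/-- All pairs of one joint type `Q` have the same channel probability, and `|T_Q| exp(n f(Q)) /
|T_P|` is `exp(-n D(Q))` up to polynomial factors. There are polynomially many joint types, so a
bound for each bounds the sum. -/
theorem expect_vecProb_le (hn : 0 < n) (hW : ∀ x, W x ∈ stdSimplex ℝ Y)
    (hT : (typeClass P n).Nonempty) {ω : (X × Y → ℝ) → ℝ} {B : ℝ}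
    (hB : 0 ≤ B) (h : ∀ x ∈ typeClass P n, ∀ y : Fin n → Y, jointEmpDist x y ∈ admissible P W →
      Real.exp (-(n * divR P W (jointEmpDist x y))) * ω (jointEmpDist x y) ≤ B) :
    (𝔼 x ∈ typeClass P n, ∑ y, vecProb W x y * ω (jointEmpDist x y)) ≤
      Real.exp (typeConst X Y * polyLog n) * B := by
  classical
  obtain ⟨x₀, hx₀⟩ := hT
  have hTpos := card_typeClass_pos_of_mem hx₀
  have hlam := polyLog_nonneg n
  rw [Finset.expect_eq_sum_div_card, div_le_iff₀ hTpos]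
  have e1 : ∑ x ∈ typeClass P n, ∑ y, vecProb W x y * ω (jointEmpDist x y) =
      ∑ p ∈ typeClass P n ×ˢ (Finset.univ : Finset (Fin n → Y)),
        vecProb W p.1 p.2 * ω (jointEmpDist p.1 p.2) := by
    rw [Finset.sum_product]
  set J : Finset (X × Y → ℝ) := (Finset.univ : Finset (Fin n → X × Y)).image empDist with hJ
  have e2 := Finset.sum_fiberwise_of_maps_to
    (s := typeClass P n ×ˢ (Finset.univ : Finset (Fin n → Y))) (t := J)
    (g := fun p => jointEmpDist p.1 p.2)
    (fun p _ => Finset.mem_image.2 ⟨fun i => (p.1 i, p.2 i), Finset.mem_univ _, rfl⟩)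
    (fun p => vecProb W p.1 p.2 * ω (jointEmpDist p.1 p.2))
  rw [e1, ← e2]
  have hT1 : Real.exp (n * ent P - Fintype.card X * polyLog n) ≤ (typeClass P n).card := by
    have := le_card_typeClass hn x₀
    rwa [mem_typeClass.1 hx₀] at this
  have key : ∀ Q ∈ J, ∑ p ∈ (typeClass P n ×ˢ (Finset.univ : Finset (Fin n → Y))).filter
      (fun p => jointEmpDist p.1 p.2 = Q), vecProb W p.1 p.2 * ω (jointEmpDist p.1 p.2) ≤
      Real.exp ((1 + Fintype.card X) * polyLog n) * B * (typeClass P n).card := by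
    intro Q _
    by_cases hex : ∃ p ∈ (typeClass P n ×ˢ (Finset.univ : Finset (Fin n → Y))).filter
      (fun p => jointEmpDist p.1 p.2 = Q), vecProb W p.1 p.2 ≠ 0
    · obtain ⟨p, hp, hpne⟩ := hex
      rw [Finset.mem_filter, Finset.mem_product] at hp
      obtain ⟨⟨hpT, -⟩, rfl⟩ := hp
      set Q := jointEmpDist p.1 p.2 with hQdef
      have hsupp := supp_of_vecProb_ne_zero hpne
      have hadm : Q ∈ admissible P W := ⟨jointEmpDist_mem_jointDist hn hpT _, hsupp⟩
      have hb := h p.1 hpT p.2 hadm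
      rw [Finset.sum_congr rfl (g := fun _ => Real.exp (n * llr W Q) * ω Q) (by
        intro p' hp'
        have hq := (Finset.mem_filter.1 hp').2
        rw [vecProb_eq_exp hn hW (by rw [hq]; exact hsupp), hq]), Finset.sum_const,
        nsmul_eq_mul, card_filter_jointEmpDist Q hadm.1.2]
      have hT2 : ((typeClass Q n).card : ℝ) ≤ Real.exp (n * ent Q + polyLog n) :=
        card_typeClass_le hn (fun i => (p.1 i, p.2 i))
      have e3 : Real.exp (n * llr W Q) * ω Q = Real.exp (n * ent P - n * ent Q) *
          (Real.exp (-(n * divR P W Q)) * ω Q) := by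
        rw [← mul_assoc, ← Real.exp_add]
        congr 2
        unfold divR; ring
      rw [e3]
      calc ((typeClass Q n).card : ℝ) * (Real.exp (n * ent P - n * ent Q) *
          (Real.exp (-(n * divR P W Q)) * ω Q))
          ≤ (typeClass Q n).card * (Real.exp (n * ent P - n * ent Q) * B) := by gcongr
        _ ≤ Real.exp (n * ent Q + polyLog n) * (Real.exp (n * ent P - n * ent Q) * B) := by
          gcongr
        _ = Real.exp ((1 + Fintype.card X) * polyLog n) * B *
            Real.exp (n * ent P - Fintype.card X * polyLog n) := by
          rw [← mul_assoc, ← Real.exp_add, mul_right_comm, ← Real.exp_add]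
          congr 2; ring
        _ ≤ _ := by gcongr
    -- Joint types that charge a forbidden transition contribute nothing.
    · push Not at hex
      rw [Finset.sum_eq_zero fun p hp => by rw [hex p hp, zero_mul]]
      positivity
  refine (Finset.sum_le_sum key).trans ?_
  rw [Finset.sum_const, nsmul_eq_mul, ← mul_assoc, ← mul_assoc]
  refine mul_le_mul_of_nonneg_right (mul_le_mul_of_nonneg_right ?_ hB) hTpos.le
  refine (mul_le_mul_of_nonneg_right (card_image_empDist_le n) (Real.exp_nonneg _)).trans ?_
  rw [← Real.exp_add, ← add_mul]
  refine Real.exp_le_exp.2 (mul_le_mul_of_nonneg_right ?_ hlam)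
  unfold typeConst
  have : (0 : ℝ) ≤ Fintype.card (X × Y) := by positivity
  have : (0 : ℝ) ≤ Fintype.card Y := by positivity
  linarith

open Classical in
-- The matching lower bound, for a single joint type.
theorem le_expect_vecProb (hn : 0 < n) (hW : ∀ x, W x ∈ stdSimplex ℝ Y) {x₀ : Fin n → X}
    {y₀ : Fin n → Y} (hQ : jointEmpDist x₀ y₀ ∈ admissible P W) :
    Real.exp (-(n * divR P W (jointEmpDist x₀ y₀)) - typeConst X Y * polyLog n) ≤
      𝔼 x ∈ typeClass P n, ∑ y, if jointEmpDist x y = jointEmpDist x₀ y₀ then vecProb W x y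
        else 0 := by
  set Q := jointEmpDist x₀ y₀ with hQdef
  have hx₀ : x₀ ∈ typeClass P n := by
    rw [mem_typeClass, ← margX_jointEmpDist x₀ y₀, ← hQdef, hQ.1.2]
  have hTpos := card_typeClass_pos_of_mem hx₀
  have hlam := polyLog_nonneg n
  rw [Finset.expect_eq_sum_div_card, le_div_iff₀ hTpos]
  have e1 : (∑ x ∈ typeClass P n, ∑ y, if jointEmpDist x y = Q then vecProb W x y else 0) =
      (typeClass Q n).card * Real.exp (n * llr W Q) := by
    rw [← Finset.sum_product', ← Finset.sum_filter, Finset.sum_congr rfl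
      (g := fun _ => Real.exp (n * llr W Q)) (by
        intro p' hp'
        have hq := (Finset.mem_filter.1 hp').2
        rw [vecProb_eq_exp hn hW (by rw [hq]; exact hQ.2), hq]), Finset.sum_const,
      nsmul_eq_mul]
    congr 2
    convert card_filter_jointEmpDist Q hQ.1.2 using 2
  rw [e1]
  have hT1 : ((typeClass P n).card : ℝ) ≤ Real.exp (n * ent P + polyLog n) := by
    have := card_typeClass_le hn x₀
    rwa [mem_typeClass.1 hx₀] at this
  have hT2 : Real.exp (n * ent Q - Fintype.card (X × Y) * polyLog n) ≤ (typeClass Q n).card :=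
    le_card_typeClass hn (fun i => (x₀ i, y₀ i))
  calc _ ≤ Real.exp (-(n * divR P W Q) - typeConst X Y * polyLog n) *
        Real.exp (n * ent P + polyLog n) := by gcongr
    _ ≤ Real.exp (n * ent Q - Fintype.card (X × Y) * polyLog n) * Real.exp (n * llr W Q) := by
      rw [← Real.exp_add, ← Real.exp_add, Real.exp_le_exp]
      have : (1 + Fintype.card (X × Y)) * polyLog n ≤ typeConst X Y * polyLog n := by
        refine mul_le_mul_of_nonneg_right ?_ hlam
        unfold typeConst
        have : (0 : ℝ) ≤ Fintype.card (X × Y) := by positivity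
        have : (0 : ℝ) ≤ Fintype.card X := by positivity
        have : (0 : ℝ) ≤ Fintype.card Y := by positivity
        linarith
      unfold divR
      nlinarith
    _ ≤ _ := by gcongr

open Classical in
-- Double counting: the joint type class is fibred over the output type class, and permuting
-- coordinates identifies all fibres.
theorem card_filter_mul_card_typeClass {x₀ : Fin n → X} (hx₀ : x₀ ∈ typeClass P n)
    (y : Fin n → Y) :
    ((typeClass P n).filter fun x => jointEmpDist x y = jointEmpDist x₀ y).card *
      (typeClass (empDist y) n).card = (typeClass (jointEmpDist x₀ y) n).card := by
  set Q := jointEmpDist x₀ y with hQ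
  have hmX : margX Q = P := by rw [hQ, margX_jointEmpDist, mem_typeClass.1 hx₀]
  rw [← card_filter_jointEmpDist Q hmX, Finset.card_eq_sum_card_fiberwise
    (f := Prod.snd) (t := typeClass (empDist y) n)]
  · rw [Finset.sum_congr rfl (g := fun _ =>
      ((typeClass P n).filter fun x => jointEmpDist x y = Q).card), Finset.sum_const,
      smul_eq_mul, mul_comm]
    intro y' hy'
    obtain ⟨σ, rfl⟩ := exists_perm_of_empDist_eq (mem_typeClass.1 hy').symm
    symm
    refine Finset.card_bij (fun x _ => (x ∘ σ, y ∘ σ)) ?_ ?_ ?_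
    · intro x hx
      rw [Finset.mem_filter] at hx
      simp only [Finset.mem_filter, Finset.mem_product, Finset.mem_univ, and_true]
      exact ⟨comp_perm_mem_typeClass hx.1 σ, by rw [jointEmpDist_comp_perm, hx.2]⟩
    · intro x _ x' _ h
      exact σ.surjective.injective_comp_right (Prod.mk.inj h).1
    · rintro ⟨x, y'⟩ hx
      simp only [Finset.mem_filter, Finset.mem_product, Finset.mem_univ, and_true] at hx
      obtain ⟨⟨h1, h2⟩, h3⟩ := hx
      have h4 : (x ∘ σ.symm) ∘ σ = x := by ext1 i; simp
      refine ⟨x ∘ σ.symm, ?_, by rw [h4, h3]⟩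
      rw [Finset.mem_filter]
      refine ⟨comp_perm_mem_typeClass h1 _, ?_⟩
      rw [← jointEmpDist_comp_perm _ _ σ, h4, ← h3, h2]
  · intro p hp
    have h := (Finset.mem_filter.1 hp).2
    refine mem_typeClass.2 ?_
    have := congrArg margY h
    rwa [margY_jointEmpDist, hQ, margY_jointEmpDist] at this

theorem mutualInfo_jointEmpDist {x₀ : Fin n → X} (hx₀ : x₀ ∈ typeClass P n) (y : Fin n → Y) :
    mutualInfo (jointEmpDist x₀ y) = ent P + ent (empDist y) - ent (jointEmpDist x₀ y) := by
  rw [mutualInfo_eq (Q := jointEmpDist x₀ y) (empDist_nonneg _), margX_jointEmpDist, margY_jointEmpDist,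
    mem_typeClass.1 hx₀]

open Classical in
/-- The probability that a random codeword has a given joint type with a fixed output vector. -/
def jointTypeProb (P : X → ℝ) (Q : X × Y → ℝ) (y : Fin n → Y) : ℝ :=
  𝔼 x ∈ typeClass P n, if jointEmpDist x y = Q then (1 : ℝ) else 0

open Classical in
theorem jointTypeProb_eq (Q : X × Y → ℝ) (y : Fin n → Y) :
    jointTypeProb P Q y =
      ((typeClass P n).filter fun x => jointEmpDist x y = Q).card / (typeClass P n).card := by
  rw [jointTypeProb, Finset.expect_eq_sum_div_card, Finset.sum_boole]

/-- The probability is `|T_Q| / (|T_P| |T_{Q_Y}|)`, whose exponent is `H(P) + H(Q_Y) - H(Q) = I(Q)`.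
-/
theorem jointTypeProb_le (hn : 0 < n) {x₀ : Fin n → X} (hx₀ : x₀ ∈ typeClass P n)
    (y : Fin n → Y) : jointTypeProb P (jointEmpDist x₀ y) y ≤
      Real.exp (-(n * mutualInfo (jointEmpDist x₀ y)) +
        (1 + Fintype.card X + Fintype.card Y) * polyLog n) := by
  classical
  have hTpos := card_typeClass_pos_of_mem hx₀
  have hYpos : (0 : ℝ) < (typeClass (empDist y) n).card := by
    exact_mod_cast card_typeClass_pos y
  have h := card_filter_mul_card_typeClass hx₀ y
  have hT1 := le_card_typeClass hn x₀
  rw [mem_typeClass.1 hx₀] at hT1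
  have hT2 := le_card_typeClass hn y
  have hT3 : ((typeClass (jointEmpDist x₀ y) n).card : ℝ) ≤ _ :=
    card_typeClass_le hn (fun i => (x₀ i, y i))
  rw [jointTypeProb_eq, div_le_iff₀ hTpos, ← mul_le_mul_iff_left₀ hYpos, ← Nat.cast_mul, h]
  refine hT3.trans ?_
  rw [mutualInfo_jointEmpDist hx₀]
  calc _ = Real.exp (-(n * (ent P + ent (empDist y) - ent (jointEmpDist x₀ y))) +
        (1 + Fintype.card X + Fintype.card Y) * polyLog n) *
        Real.exp (n * ent P - Fintype.card X * polyLog n) *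
        Real.exp (n * ent (empDist y) - Fintype.card Y * polyLog n) := by
        rw [← Real.exp_add, ← Real.exp_add]
        congr 1
        unfold jointEmpDist
        ring
    _ ≤ _ := by gcongr

theorem le_jointTypeProb (hn : 0 < n) {x₀ : Fin n → X} (hx₀ : x₀ ∈ typeClass P n)
    (y : Fin n → Y) : Real.exp (-(n * mutualInfo (jointEmpDist x₀ y)) -
      typeConst X Y * polyLog n) ≤ jointTypeProb P (jointEmpDist x₀ y) y := by
  classical
  have hTpos := card_typeClass_pos_of_mem hx₀
  have hYpos : (0 : ℝ) < (typeClass (empDist y) n).card := by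
    exact_mod_cast card_typeClass_pos y
  have hlam := polyLog_nonneg n
  have h := card_filter_mul_card_typeClass hx₀ y
  have hT1 := card_typeClass_le hn x₀
  rw [mem_typeClass.1 hx₀] at hT1
  have hT2 := card_typeClass_le hn y
  have hT3 : _ ≤ ((typeClass (jointEmpDist x₀ y) n).card : ℝ) :=
    le_card_typeClass hn (fun i => (x₀ i, y i))
  rw [jointTypeProb_eq, le_div_iff₀ hTpos, ← mul_le_mul_iff_left₀ hYpos, ← Nat.cast_mul, h]
  refine le_trans ?_ hT3
  rw [mutualInfo_jointEmpDist hx₀]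
  calc _ ≤ Real.exp (-(n * (ent P + ent (empDist y) - ent (jointEmpDist x₀ y))) -
        typeConst X Y * polyLog n) *
        Real.exp (n * ent P + polyLog n) *
        Real.exp (n * ent (empDist y) + polyLog n) := by gcongr
    _ ≤ _ := by
        rw [← Real.exp_add, ← Real.exp_add, Real.exp_le_exp]
        have : (2 + Fintype.card (X × Y)) * polyLog n ≤ typeConst X Y * polyLog n := by
          refine mul_le_mul_of_nonneg_right ?_ hlam
          unfold typeConst
          have : (0 : ℝ) ≤ Fintype.card (X × Y) := by positivity
          have : (0 : ℝ) ≤ Fintype.card X := by positivity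
          have : (0 : ℝ) ≤ Fintype.card Y := by positivity
          linarith
        change _ ≤ n * ent (jointEmpDist x₀ y) - _
        nlinarith

/-- Union bound over the polynomially many joint types satisfying `Φ`. -/
theorem expect_indicator_le (hn : 0 < n) (hT : (typeClass P n).Nonempty) (y : Fin n → Y)
    {Φ : (X × Y → ℝ) → Prop} [DecidablePred Φ] {B : ℝ} (hB : 0 ≤ B)
    (h : ∀ x ∈ typeClass P n, Φ (jointEmpDist x y) →
      Real.exp (-(n * mutualInfo (jointEmpDist x y))) ≤ B) :
    (𝔼 x ∈ typeClass P n, if Φ (jointEmpDist x y) then (1 : ℝ) else 0) ≤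
      Real.exp (typeConst X Y * polyLog n) * B := by
  classical
  obtain ⟨x₀, hx₀⟩ := hT
  have hTpos := card_typeClass_pos_of_mem hx₀
  have hlam := polyLog_nonneg n
  set J : Finset (X × Y → ℝ) := (Finset.univ : Finset (Fin n → X × Y)).image empDist with hJ
  have e2 := Finset.sum_fiberwise_of_maps_to
    (s := typeClass P n) (t := J) (g := fun x => jointEmpDist x y)
    (fun x _ => Finset.mem_image.2 ⟨fun i => (x i, y i), Finset.mem_univ _, rfl⟩)
    (fun x => if Φ (jointEmpDist x y) then (1 : ℝ) else 0)
  rw [Finset.expect_eq_sum_div_card, ← e2, Finset.sum_div]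
  have key : ∀ Q ∈ J, (∑ x ∈ (typeClass P n).filter (fun x => jointEmpDist x y = Q),
      if Φ (jointEmpDist x y) then (1 : ℝ) else 0) / (typeClass P n).card ≤
      Real.exp ((1 + Fintype.card X + Fintype.card Y) * polyLog n) * B := by
    intro Q _
    by_cases hex : ∃ x ∈ (typeClass P n).filter (fun x => jointEmpDist x y = Q),
      Φ (jointEmpDist x y)
    · obtain ⟨x, hx, hΦ⟩ := hex
      obtain ⟨hxT, rfl⟩ := Finset.mem_filter.1 hx
      have h1 := jointTypeProb_le hn hxT y
      rw [jointTypeProb_eq] at h1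
      rw [Finset.sum_congr rfl (g := fun _ => (1 : ℝ)) (by
        intro x' hx'
        rw [(Finset.mem_filter.1 hx').2, if_pos hΦ]), Finset.sum_const, nsmul_eq_mul, mul_one]
      refine h1.trans ?_
      rw [Real.exp_add, mul_comm]
      exact mul_le_mul_of_nonneg_left (h x hxT hΦ) (Real.exp_nonneg _)
    · push Not at hex
      rw [Finset.sum_eq_zero fun p hp => if_neg (hex p hp), zero_div]
      positivity
  refine (Finset.sum_le_sum key).trans ?_
  rw [Finset.sum_const, nsmul_eq_mul, ← mul_assoc]
  refine mul_le_mul_of_nonneg_right ?_ hB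
  refine (mul_le_mul_of_nonneg_right (card_image_empDist_le n) (Real.exp_nonneg _)).trans ?_
  rw [← Real.exp_add, ← add_mul]
  refine Real.exp_le_exp.2 (mul_le_mul_of_nonneg_right ?_ hlam)
  unfold typeConst
  have : (0 : ℝ) ≤ Fintype.card (X × Y) := by positivity
  linarith

/-- By permutation symmetry, a joint type realized with one output vector is realized with every
output vector of the same type. -/
theorem exists_jointEmpDist_eq {x₁ : Fin n → X} {y₁ y : Fin n → Y} (hx₁ : x₁ ∈ typeClass P n)
    (h : empDist y = empDist y₁) :
    ∃ x ∈ typeClass P n, jointEmpDist x y = jointEmpDist x₁ y₁ := by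
  obtain ⟨σ, rfl⟩ := exists_perm_of_empDist_eq h.symm
  exact ⟨x₁ ∘ σ, comp_perm_mem_typeClass hx₁ σ, jointEmpDist_comp_perm _ _ _⟩

end JointType

/-! ### Averages over the random codebook -/

section Ensemble

variable {X Y : Type*} [Fintype X] [DecidableEq X] [Fintype Y] [DecidableEq Y]
  {P : X → ℝ} {W : X → Y → ℝ} {n M : ℕ}

theorem ensembleAvg_mono {F G : (Fin M → Fin n → X) → ℝ}
    (h : ∀ C ∈ Fintype.piFinset (fun _ : Fin M => typeClass P n), F C ≤ G C) :
    ensembleAvg P n M F ≤ ensembleAvg P n M G :=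
  Finset.expect_le_expect h

theorem ensembleAvg_sum {ι : Type*} (s : Finset ι) (F : ι → (Fin M → Fin n → X) → ℝ) :
    ensembleAvg P n M (fun C => ∑ i ∈ s, F i C) = ∑ i ∈ s, ensembleAvg P n M (F i) :=
  Finset.expect_sum_comm _ _ _

theorem ensembleAvg_mul_left (c : ℝ) (F : (Fin M → Fin n → X) → ℝ) :
    ensembleAvg P n M (fun C => c * F C) = c * ensembleAvg P n M F :=
  (Finset.mul_expect _ _ _).symm

theorem ensembleAvg_sub (F G : (Fin M → Fin n → X) → ℝ) :
    ensembleAvg P n M (fun C => F C - G C) = ensembleAvg P n M F - ensembleAvg P n M G :=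
  Finset.expect_sub_distrib _ _ _

/-- Independence of the codewords. -/
theorem ensembleAvg_prod (F : Fin M → (Fin n → X) → ℝ) :
    ensembleAvg P n M (fun C => ∏ k, F k (C k)) = ∏ k, 𝔼 x ∈ typeClass P n, F k x := by
  simp only [ensembleAvg, Finset.expect_eq_sum_div_card]
  rw [Finset.prod_div_distrib, Finset.prod_univ_sum, Fintype.card_piFinset]
  push_cast
  rfl

theorem prod_ite_eq_mul (m : Fin M) (a : ℝ) (c : Fin M → ℝ) :
    ∏ k, (if k = m then a else c k) = a * ∏ k ∈ Finset.univ.erase m, c k := by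
  rw [← Finset.mul_prod_erase _ _ (Finset.mem_univ m), if_pos rfl]
  congr 1
  exact Finset.prod_congr rfl fun k hk => if_neg (Finset.ne_of_mem_erase hk)

theorem prod_ite_ite_eq_mul {m l : Fin M} (hml : l ≠ m) (a b : ℝ) (c : Fin M → ℝ) :
    ∏ k, (if k = m then a else if k = l then b else c k) =
      a * (b * ∏ k ∈ (Finset.univ.erase m).erase l, c k) := by
  rw [prod_ite_eq_mul, ← Finset.mul_prod_erase _ _
    (Finset.mem_erase.2 ⟨hml, Finset.mem_univ l⟩), if_pos rfl]
  congr 2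
  exact Finset.prod_congr rfl fun k hk => if_neg (Finset.ne_of_mem_erase hk)

theorem ensembleAvg_mul_prod (m : Fin M) (F c : (Fin n → X) → ℝ) :
    ensembleAvg P n M (fun C => F (C m) * ∏ k ∈ Finset.univ.erase m, c (C k)) =
      (𝔼 x ∈ typeClass P n, F x) * (𝔼 x ∈ typeClass P n, c x) ^ (M - 1) := by
  have h := ensembleAvg_prod (P := P) fun k : Fin M => if k = m then F else c
  simp only [ite_apply] at h
  have h1 : (fun C : Fin M → Fin n → X => ∏ k, if k = m then F (C k) else c (C k)) =
      fun C => F (C m) * ∏ k ∈ Finset.univ.erase m, c (C k) := by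
    ext1 C
    rw [← prod_ite_eq_mul]
    refine Finset.prod_congr rfl fun k _ => ?_
    split_ifs with hk
    · rw [hk]
    · rfl
  rw [h1] at h
  rw [h]
  have h2 : ∀ k, (𝔼 x ∈ typeClass P n, if k = m then F x else c x) =
      if k = m then 𝔼 x ∈ typeClass P n, F x else 𝔼 x ∈ typeClass P n, c x := by
    intro k; split_ifs <;> rfl
  simp only [h2, prod_ite_eq_mul, Finset.prod_const, Finset.card_erase_of_mem (Finset.mem_univ m),
    Finset.card_univ, Fintype.card_fin]

/-- Intended for `m` transmitted, `l` wrongly listed, and a condition on each of the other `M - 2`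
codewords; `l ≠ m` forces `M ≥ 2`, so the subtraction does not truncate. -/
theorem ensembleAvg_mul_mul_prod {m l : Fin M} (hml : l ≠ m) (F G c : (Fin n → X) → ℝ) :
    ensembleAvg P n M
      (fun C => F (C m) * (G (C l) * ∏ k ∈ (Finset.univ.erase m).erase l, c (C k))) =
      (𝔼 x ∈ typeClass P n, F x) *
        ((𝔼 x ∈ typeClass P n, G x) * (𝔼 x ∈ typeClass P n, c x) ^ (M - 2)) := by
  have h := ensembleAvg_prod (P := P)
    fun k : Fin M => if k = m then F else if k = l then G else c
  simp only [ite_apply] at h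
  have h1 : (fun C : Fin M → Fin n → X =>
      ∏ k, if k = m then F (C k) else if k = l then G (C k) else c (C k)) =
      fun C => F (C m) * (G (C l) * ∏ k ∈ (Finset.univ.erase m).erase l, c (C k)) := by
    ext1 C
    rw [← prod_ite_ite_eq_mul hml]
    refine Finset.prod_congr rfl fun k _ => ?_
    split_ifs with hk hk'
    · rw [hk]
    · rw [hk']
    · rfl
  rw [h1] at h
  rw [h]
  have h2 : ∀ k, (𝔼 x ∈ typeClass P n, if k = m then F x else if k = l then G x else c x) =
      if k = m then 𝔼 x ∈ typeClass P n, F x else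
      if k = l then 𝔼 x ∈ typeClass P n, G x else 𝔼 x ∈ typeClass P n, c x := by
    intro k; split_ifs <;> rfl
  have h3 : ((Finset.univ.erase m).erase l).card = M - 2 := by
    rw [Finset.card_erase_of_mem (Finset.mem_erase.2 ⟨hml, Finset.mem_univ l⟩),
      Finset.card_erase_of_mem (Finset.mem_univ m), Finset.card_univ, Fintype.card_fin]
    rfl
  simp only [h2, prod_ite_ite_eq_mul hml, Finset.prod_const, h3]

theorem ensembleAvg_comp (hT : (typeClass P n).Nonempty) (m : Fin M) (F : (Fin n → X) → ℝ) :
    ensembleAvg P n M (fun C => F (C m)) = 𝔼 x ∈ typeClass P n, F x := by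
  have := ensembleAvg_mul_prod (P := P) m F fun _ => 1
  simpa [Finset.expect_const hT] using this

theorem ensembleAvg_mul (hT : (typeClass P n).Nonempty) {m l : Fin M} (hml : l ≠ m)
    (F G : (Fin n → X) → ℝ) :
    ensembleAvg P n M (fun C => F (C m) * G (C l)) =
      (𝔼 x ∈ typeClass P n, F x) * 𝔼 x ∈ typeClass P n, G x := by
  have := ensembleAvg_mul_mul_prod (P := P) hml F G fun _ => 1
  simpa [Finset.expect_const hT] using this

/-! ### Average error probability and list size at finite blocklength -/

open Classical in
-- Whether `m` is listed depends on its own codeword and the output only, so all messages contribute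
-- equally.
theorem ensembleAvg_errorProb_output_le (hW : ∀ x, W x ∈ stdSimplex ℝ Y)
    (hT : (typeClass P n).Nonempty) (g : (Y → ℝ) → EReal) :
    ensembleAvg P n M (fun C => errorProb W (outputThresholdDecoder W g) C) ≤
      𝔼 x ∈ typeClass P n, ∑ y, vecProb W x y *
        if g (margY (jointEmpDist x y)) ≤ logLik W (jointEmpDist x y) then 0 else 1 := by
  set F : (Fin n → X) → ℝ := fun x => ∑ y, vecProb W x y *
        if g (margY (jointEmpDist x y)) ≤ logLik W (jointEmpDist x y) then 0 else 1 with hF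
  have hF0 : 0 ≤ 𝔼 x ∈ typeClass P n, F x :=
    Finset.expect_nonneg fun x _ => Finset.sum_nonneg fun y _ =>
      mul_nonneg (vecProb_nonneg hW x y) (by split_ifs <;> norm_num)
  have h1 : ∀ C : Fin M → Fin n → X, errorProb W (outputThresholdDecoder W g) C =
      (1 / (M : ℝ)) * ∑ m, F (C m) := by
    intro C
    unfold errorProb
    congr 1
    refine Finset.sum_congr rfl fun m _ => Finset.sum_congr rfl fun y _ => ?_
    simp only [outputThresholdDecoder, Finset.mem_filter, Finset.mem_univ, true_and,
      margY_jointEmpDist, mul_ite, mul_zero, mul_one]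
  simp only [h1]
  rw [ensembleAvg_mul_left, ensembleAvg_sum, Finset.sum_congr rfl fun m _ =>
    ensembleAvg_comp hT m F, Finset.sum_const, nsmul_eq_mul, Finset.card_univ, Fintype.card_fin,
    ← mul_assoc]
  refine mul_le_of_le_one_left hF0 ?_
  -- With no codewords the factor `1 / M` is `0`, which is why only an inequality is claimed.
  rcases eq_or_ne (M : ℝ) 0 with h | h
  · simp [h]
  · rw [one_div_mul_cancel h]

open Classical in
-- A wrong codeword is independent of the transmitted one, and there are at most `M` of them.
theorem ensembleAvg_listSize_output_le (hW : ∀ x, W x ∈ stdSimplex ℝ Y)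
    (hT : (typeClass P n).Nonempty) (g : (Y → ℝ) → EReal) :
    ensembleAvg P n M (fun C => listSize W (outputThresholdDecoder W g) C) ≤
      M * 𝔼 x ∈ typeClass P n, ∑ y, vecProb W x y *
        𝔼 x' ∈ typeClass P n,
          if g (empDist y) ≤ logLik W (jointEmpDist x' y) then (1 : ℝ) else 0 := by
  set G : (Fin n → Y) → (Fin n → X) → ℝ := fun y x' =>
    if g (empDist y) ≤ logLik W (jointEmpDist x' y) then (1 : ℝ) else 0 with hG
  have hG0 : ∀ y, 0 ≤ 𝔼 x ∈ typeClass P n, G y x := fun y =>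
    Finset.expect_nonneg fun x _ => by simp only [hG]; split_ifs <;> norm_num
  have hV0 : ∀ y, 0 ≤ 𝔼 x ∈ typeClass P n, vecProb W x y := fun y =>
    Finset.expect_nonneg fun x _ => vecProb_nonneg hW x y
  have h1 : ∀ C : Fin M → Fin n → X, listSize W (outputThresholdDecoder W g) C =
      ∑ y, (1 / (M : ℝ)) * ∑ m, ∑ l ∈ Finset.univ.filter (fun l => l ≠ m),
        vecProb W (C m) y * G y (C l) := by
    intro C
    unfold listSize
    refine Finset.sum_congr rfl fun y _ => ?_
    congr 1
    refine Finset.sum_congr rfl fun m _ => ?_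
    rw [Finset.mul_sum]
    refine Finset.sum_congr rfl fun l _ => ?_
    simp only [outputThresholdDecoder, Finset.mem_filter, Finset.mem_univ, true_and, hG]
  simp only [h1]
  rw [ensembleAvg_sum, Finset.expect_sum_comm, Finset.mul_sum]
  refine Finset.sum_le_sum fun y _ => ?_
  rw [ensembleAvg_mul_left, ensembleAvg_sum, ← Finset.expect_mul]
  set A := (𝔼 x ∈ typeClass P n, vecProb W x y) * 𝔼 x ∈ typeClass P n, G y x with hA
  have hA0 : 0 ≤ A := mul_nonneg (hV0 y) (hG0 y)
  have h2 : ∀ m : Fin M, ensembleAvg P n M (fun C => ∑ l ∈ Finset.univ.filter (fun l => l ≠ m),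
        vecProb W (C m) y * G y (C l)) ≤ M * A := by
    intro m
    rw [ensembleAvg_sum, Finset.sum_congr rfl (g := fun _ => A) fun l hl =>
      ensembleAvg_mul hT (Finset.mem_filter.1 hl).2 (fun x => vecProb W x y) (G y),
      Finset.sum_const, nsmul_eq_mul]
    refine mul_le_mul_of_nonneg_right ?_ hA0
    exact_mod_cast (Finset.card_filter_le _ _).trans_eq (by simp)
  calc _ ≤ 1 / (M : ℝ) * ∑ _m : Fin M, M * A :=
        mul_le_mul_of_nonneg_left (Finset.sum_le_sum fun m _ => h2 m) (by positivity)
    _ = (1 / (M : ℝ) * M) * (M * A) := by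
        rw [Finset.sum_const, nsmul_eq_mul, Finset.card_univ, Fintype.card_fin, mul_assoc]
    _ ≤ _ := by
        refine mul_le_of_le_one_left (by positivity) ?_
        rcases eq_or_ne (M : ℝ) 0 with h | h
        · simp [h]
        · rw [one_div_mul_cancel h]

/-- The transmitted message is erased as soon as its joint type is that of `(x₁, y₁)` and some
competitor has that of `(x₂, y₁)`. The second factor bounds below the chance that at least one of `M
- 1` independent competitors does. -/
theorem le_ensembleAvg_errorProb_joint (hn : 0 < n) (hM : 0 < M)
    (hW : ∀ x, W x ∈ stdSimplex ℝ Y) {h : (X × Y → ℝ) → EReal} {x₁ x₂ : Fin n → X}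
    {y₁ : Fin n → Y} (hQ : jointEmpDist x₁ y₁ ∈ admissible P W) (hx₂ : x₂ ∈ typeClass P n)
    (hlt : (llr W (jointEmpDist x₁ y₁) : EReal) < h (jointEmpDist x₂ y₁)) :
    Real.exp (-(n * divR P W (jointEmpDist x₁ y₁)) - typeConst X Y * polyLog n) *
      (1 - (1 - Real.exp (-(n * mutualInfo (jointEmpDist x₂ y₁)) -
        typeConst X Y * polyLog n)) ^ (M - 1)) ≤
      ensembleAvg P n M (fun C => errorProb W (jointThresholdDecoder W h) C) := by
  classical
  set Q := jointEmpDist x₁ y₁ with hQdef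
  set Q₂ := jointEmpDist x₂ y₁ with hQ₂def
  set ρ := Real.exp (-(n * mutualInfo Q₂) - typeConst X Y * polyLog n) with hρ
  have hT : (typeClass P n).Nonempty := ⟨x₂, hx₂⟩
  set a : (Fin n → Y) → (Fin n → X) → ℝ := fun y x =>
    if jointEmpDist x y = Q then vecProb W x y else 0 with ha
  -- The product of `b` over the competitors indicates that none of them has joint type `Q₂`.
  set b : (Fin n → Y) → (Fin n → X) → ℝ := fun y x =>
    1 - if jointEmpDist x y = Q₂ then (1 : ℝ) else 0 with hb
  have ha0 : ∀ y x, 0 ≤ a y x := fun y x => by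
    simp only [ha]; split_ifs
    · exact vecProb_nonneg hW x y
    · exact le_rfl
  have h1 : ∀ C : Fin M → Fin n → X,
      (1 / (M : ℝ)) * ∑ m, ∑ y, (a y (C m) * 1 -
        a y (C m) * ∏ k ∈ Finset.univ.erase m, b y (C k)) ≤
      errorProb W (jointThresholdDecoder W h) C := by
    intro C
    unfold errorProb
    refine mul_le_mul_of_nonneg_left (Finset.sum_le_sum fun m _ =>
      Finset.sum_le_sum fun y _ => ?_) (by positivity)
    have hb1 : ∀ k, 0 ≤ b y (C k) := fun k => by simp only [hb]; split_ifs <;> norm_num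
    have hp0 : 0 ≤ ∏ k ∈ Finset.univ.erase m, b y (C k) := Finset.prod_nonneg fun k _ => hb1 k
    rw [← mul_sub]
    by_cases hm : jointEmpDist (C m) y = Q
    · have ham : a y (C m) = vecProb W (C m) y := by simp only [ha]; rw [if_pos hm]
      rw [ham]
      have hv := vecProb_nonneg hW (C m) y
      split_ifs with hmem
      · have : ∏ k ∈ Finset.univ.erase m, b y (C k) = 1 := by
          refine Finset.prod_eq_one fun k hk => ?_
          simp only [hb]
          rw [if_neg, sub_zero]
          intro hk2
          simp only [jointThresholdDecoder, Finset.mem_filter, Finset.mem_univ, true_and,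
            iSup_le_iff, hm, logLik_eq_coe hW hQ.2] at hmem
          have := hmem k (Finset.ne_of_mem_erase hk)
          rw [hk2] at this
          exact absurd this (not_le.2 hlt)
        rw [this]; simp
      · nlinarith
    · have ham : a y (C m) = 0 := by simp only [ha]; rw [if_neg hm]
      rw [ham, zero_mul]
      split_ifs
      · exact le_rfl
      · exact vecProb_nonneg hW _ _
  refine le_trans ?_ (ensembleAvg_mono fun C _ => h1 C)
  rw [ensembleAvg_mul_left, ensembleAvg_sum]
  have hM' : (M : ℝ) ≠ 0 := by positivity
  set K := 1 - (1 - ρ) ^ (M - 1) with hK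
  have hρ2 : ∀ y : Fin n → Y, empDist y = empDist y₁ →
      (𝔼 x ∈ typeClass P n, b y x) ≤ 1 - ρ ∧ 0 ≤ 𝔼 x ∈ typeClass P n, b y x := by
    intro y hy
    constructor
    · obtain ⟨x₀, hx₀, he⟩ := exists_jointEmpDist_eq hx₂ hy
      have h3 := le_jointTypeProb hn hx₀ y
      rw [he, ← hQ₂def] at h3
      simp only [hb]
      rw [Finset.expect_sub_distrib, Finset.expect_const hT]
      unfold jointTypeProb at h3
      linarith
    · exact Finset.expect_nonneg fun x _ => by simp only [hb]; split_ifs <;> norm_num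
  have h2 : ∀ m : Fin M, (∑ y, (𝔼 x ∈ typeClass P n, a y x) * K) ≤
      ensembleAvg P n M (fun C => ∑ y, (a y (C m) * 1 -
        a y (C m) * ∏ k ∈ Finset.univ.erase m, b y (C k))) := by
    intro m
    rw [ensembleAvg_sum]
    refine Finset.sum_le_sum fun y _ => ?_
    rw [ensembleAvg_sub, ensembleAvg_mul_prod]
    simp only [mul_one]
    rw [ensembleAvg_comp hT m (a y)]
    by_cases hy : empDist y = empDist y₁
    · obtain ⟨h4, h5⟩ := hρ2 y hy
      have h6 := pow_le_pow_left₀ h5 h4 (M - 1)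
      have h7 : 0 ≤ 𝔼 x ∈ typeClass P n, a y x := Finset.expect_nonneg fun x _ => ha0 y x
      rw [hK]
      nlinarith
    · have : (𝔼 x ∈ typeClass P n, a y x) = 0 := by
        refine Finset.expect_eq_zero fun x _ => ?_
        simp only [ha]
        rw [if_neg]
        intro hx
        apply hy
        rw [← margY_jointEmpDist x, hx, hQdef, margY_jointEmpDist]
      rw [this]; simp
  have h8 : 0 ≤ K := by
    obtain ⟨h4, h5⟩ := hρ2 y₁ rfl
    have hr := Real.exp_pos (-(n * mutualInfo Q₂) - typeConst X Y * polyLog n)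
    have := pow_le_one₀ (n := M - 1) (h5.trans h4) (by rw [← hρ] at hr; linarith)
    rw [hK]; linarith
  calc _ ≤ (𝔼 x ∈ typeClass P n, ∑ y, a y x) * K :=
        mul_le_mul_of_nonneg_right (le_expect_vecProb hn hW hQ) h8
    _ = 1 / (M : ℝ) * ∑ _m : Fin M, ∑ y, (𝔼 x ∈ typeClass P n, a y x) * K := by
        rw [Finset.sum_const, nsmul_eq_mul, Finset.card_univ, Fintype.card_fin, ← mul_assoc,
          one_div_mul_cancel hM', one_mul, ← Finset.sum_mul, Finset.expect_sum_comm]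
    _ ≤ _ := mul_le_mul_of_nonneg_left (Finset.sum_le_sum fun m _ => h2 m) (by positivity)

open Classical in
-- Only one configuration is counted: the transmitted codeword has joint type `Q`, a wrong codeword
-- `l` has joint type `Q₂`, and no third codeword has a threshold above `f(Q₂)`. Then `l` is listed.
-- There are `M - 1` choices of `l`.
theorem le_ensembleAvg_listSize_joint (hn : 0 < n) (hM : 0 < M)
    (hW : ∀ x, W x ∈ stdSimplex ℝ Y) {h : (X × Y → ℝ) → EReal} {x₁ x₂ : Fin n → X}
    {y₁ : Fin n → Y} (hQ : jointEmpDist x₁ y₁ ∈ admissible P W) (hx₂ : x₂ ∈ typeClass P n)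
    (hQ₂ : ∀ a b, W a b = 0 → jointEmpDist x₂ y₁ (a, b) = 0)
    (hle : h (jointEmpDist x₁ y₁) ≤ (llr W (jointEmpDist x₂ y₁) : EReal)) {β : ℝ} (hβ1 : β ≤ 1)
    (hβ : ∀ y, empDist y = empDist y₁ → (𝔼 x ∈ typeClass P n,
      if ¬ h (jointEmpDist x y) ≤ (llr W (jointEmpDist x₂ y₁) : EReal) then (1 : ℝ) else 0) ≤ β) :
    (M - 1 : ℝ) * (Real.exp (-(n * divR P W (jointEmpDist x₁ y₁)) - typeConst X Y * polyLog n) *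
      (Real.exp (-(n * mutualInfo (jointEmpDist x₂ y₁)) - typeConst X Y * polyLog n) *
        (1 - β) ^ (M - 2))) ≤
      ensembleAvg P n M (fun C => listSize W (jointThresholdDecoder W h) C) := by
  set Q := jointEmpDist x₁ y₁ with hQdef
  set Q₂ := jointEmpDist x₂ y₁ with hQ₂def
  set ρ := Real.exp (-(n * mutualInfo Q₂) - typeConst X Y * polyLog n) with hρ
  have hT : (typeClass P n).Nonempty := ⟨x₂, hx₂⟩
  set a : (Fin n → Y) → (Fin n → X) → ℝ := fun y x =>
    if jointEmpDist x y = Q then vecProb W x y else 0 with ha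
  set b : (Fin n → Y) → (Fin n → X) → ℝ := fun y x =>
    if jointEmpDist x y = Q₂ then (1 : ℝ) else 0 with hb
  -- Indicator that a third codeword does not keep `l` off the list.
  set c : (Fin n → Y) → (Fin n → X) → ℝ := fun y x =>
    1 - if ¬ h (jointEmpDist x y) ≤ (llr W Q₂ : EReal) then (1 : ℝ) else 0 with hc
  have ha0 : ∀ y x, 0 ≤ a y x := fun y x => by
    simp only [ha]; split_ifs
    · exact vecProb_nonneg hW x y
    · exact le_rfl
  have hc0 : ∀ y x, 0 ≤ c y x := fun y x => by simp only [hc]; split_ifs <;> norm_num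
  have hc1 : ∀ y x, c y x ≤ 1 := fun y x => by simp only [hc]; split_ifs <;> norm_num
  have hb0 : ∀ y x, 0 ≤ b y x := fun y x => by simp only [hb]; split_ifs <;> norm_num
  have h1 : ∀ C : Fin M → Fin n → X,
      ∑ y, (1 / (M : ℝ)) * ∑ m, ∑ l ∈ Finset.univ.filter (fun l => l ≠ m),
        a y (C m) * (b y (C l) * ∏ k ∈ (Finset.univ.erase m).erase l, c y (C k)) ≤
      listSize W (jointThresholdDecoder W h) C := by
    intro C
    unfold listSize
    refine Finset.sum_le_sum fun y _ => mul_le_mul_of_nonneg_left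
      (Finset.sum_le_sum fun m _ => ?_) (by positivity)
    rw [Finset.mul_sum]
    refine Finset.sum_le_sum fun l hl => ?_
    have hlm := (Finset.mem_filter.1 hl).2
    by_cases hmem : l ∈ jointThresholdDecoder W h n M C y
    · rw [if_pos hmem]
      refine mul_le_mul ?_ ?_ ?_ (vecProb_nonneg hW _ _)
      · simp only [ha]; split_ifs
        · exact le_rfl
        · exact vecProb_nonneg hW _ _
      · have : b y (C l) ≤ 1 := by simp only [hb]; split_ifs <;> norm_num
        exact mul_le_one₀ this (Finset.prod_nonneg fun k _ => hc0 _ _)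
          (Finset.prod_le_one (fun k _ => hc0 _ _) fun k _ => hc1 _ _)
      · exact mul_nonneg (hb0 _ _) (Finset.prod_nonneg fun k _ => hc0 _ _)
    · rw [if_neg hmem, mul_zero]
      refine le_of_eq ?_
      by_contra hne
      have hne1 := left_ne_zero_of_mul hne
      have hne2 := left_ne_zero_of_mul (right_ne_zero_of_mul hne)
      have hne3 := right_ne_zero_of_mul (right_ne_zero_of_mul hne)
      have e1 : jointEmpDist (C m) y = Q := by
        by_contra h'; exact hne1 (by simp only [ha]; rw [if_neg h'])
      have e2 : jointEmpDist (C l) y = Q₂ := by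
        by_contra h'; exact hne2 (by simp only [hb]; rw [if_neg h'])
      apply hmem
      simp only [jointThresholdDecoder, Finset.mem_filter, Finset.mem_univ, true_and,
        iSup_le_iff, e2, logLik_eq_coe hW hQ₂]
      intro k hk
      -- The transmitted codeword is itself a competitor of `l`; its threshold is controlled by
      -- `hle`, not by `c`.
      by_cases hkm : k = m
      · rw [hkm, e1]; exact hle
      · by_contra h'
        refine Finset.prod_ne_zero_iff.1 hne3 k (Finset.mem_erase.2 ⟨hk, Finset.mem_erase.2
          ⟨hkm, Finset.mem_univ _⟩⟩) ?_
        simp only [hc]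
        rw [if_pos h', sub_self]
  refine le_trans ?_ (ensembleAvg_mono fun C _ => h1 C)
  rw [ensembleAvg_sum]
  have hM' : (M : ℝ) ≠ 0 := by positivity
  have hM1 : (0 : ℝ) ≤ M - 1 := by
    have : (1 : ℝ) ≤ M := by exact_mod_cast hM
    linarith
  have h2 : ∀ y, (M - 1 : ℝ) * ((𝔼 x ∈ typeClass P n, a y x) * (ρ * (1 - β) ^ (M - 2))) ≤
      ensembleAvg P n M (fun C => (1 / (M : ℝ)) * ∑ m,
        ∑ l ∈ Finset.univ.filter (fun l => l ≠ m),
        a y (C m) * (b y (C l) * ∏ k ∈ (Finset.univ.erase m).erase l, c y (C k))) := by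
    intro y
    rw [ensembleAvg_mul_left, ensembleAvg_sum]
    set A := (𝔼 x ∈ typeClass P n, a y x) *
        ((𝔼 x ∈ typeClass P n, b y x) * (𝔼 x ∈ typeClass P n, c y x) ^ (M - 2)) with hA
    have h3 : ∀ m : Fin M, ensembleAvg P n M (fun C => ∑ l ∈ Finset.univ.filter (fun l => l ≠ m),
        a y (C m) * (b y (C l) * ∏ k ∈ (Finset.univ.erase m).erase l, c y (C k))) =
        (M - 1 : ℝ) * A := by
      intro m
      rw [ensembleAvg_sum, Finset.sum_congr rfl (g := fun _ => A) fun l hl =>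
        ensembleAvg_mul_mul_prod (Finset.mem_filter.1 hl).2 (a y) (b y) (c y),
        Finset.sum_const, nsmul_eq_mul]
      congr 1
      rw [Finset.filter_ne', Finset.card_erase_of_mem (Finset.mem_univ m), Finset.card_univ,
        Fintype.card_fin, Nat.cast_sub hM, Nat.cast_one]
    rw [Finset.sum_congr rfl fun m _ => h3 m, Finset.sum_const, nsmul_eq_mul, Finset.card_univ,
      Fintype.card_fin, one_div, inv_mul_cancel_left₀ hM']
    refine mul_le_mul_of_nonneg_left ?_ hM1
    have ha1 : 0 ≤ 𝔼 x ∈ typeClass P n, a y x := Finset.expect_nonneg fun x _ => ha0 y x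
    by_cases hy : empDist y = empDist y₁
    · have hbρ : ρ ≤ 𝔼 x ∈ typeClass P n, b y x := by
        obtain ⟨x₀, hx₀, he⟩ := exists_jointEmpDist_eq hx₂ hy
        have h3 := le_jointTypeProb hn hx₀ y
        rw [he, ← hQ₂def] at h3
        exact h3
      have hcβ : 1 - β ≤ 𝔼 x ∈ typeClass P n, c y x := by
        simp only [hc]
        rw [Finset.expect_sub_distrib, Finset.expect_const hT]
        linarith [hβ y hy]
      have h5 := pow_le_pow_left₀ (by linarith : 0 ≤ 1 - β) hcβ (M - 2)
      exact mul_le_mul_of_nonneg_left (mul_le_mul hbρ h5 (pow_nonneg (by linarith) _)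
        ((Real.exp_nonneg _).trans hbρ)) ha1
    · have : (𝔼 x ∈ typeClass P n, a y x) = 0 := by
        refine Finset.expect_eq_zero fun x _ => ?_
        simp only [ha]
        rw [if_neg]
        intro hx
        apply hy
        rw [← margY_jointEmpDist x, hx, hQdef, margY_jointEmpDist]
      rw [hA, this]; simp
  refine le_trans ?_ (Finset.sum_le_sum fun y _ => h2 y)
  rw [← Finset.mul_sum, ← Finset.sum_mul, ← Finset.expect_sum_comm]
  refine mul_le_mul_of_nonneg_left (mul_le_mul_of_nonneg_right (le_expect_vecProb hn hW hQ)
    (mul_nonneg (Real.exp_nonneg _) (pow_nonneg (by linarith) _))) hM1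

end Ensemble

/-! ### Exponents -/

section Exponent

variable {X Y : Type*} [Fintype X] [DecidableEq X] [Fintype Y] [DecidableEq Y]
  {P : X → ℝ} {W : X → Y → ℝ} {n : ℕ}

theorem le_neg_inv_mul_log {a s : ℝ} (hn : 0 < n) (h : a ≤ Real.exp (-(n * s))) :
    (s : EReal) ≤ ((-(1 / (n : ℝ)) : ℝ) : EReal) * ENNReal.log (ENNReal.ofReal a) := by
  have hn' : (0 : ℝ) < n := by exact_mod_cast hn
  rcases le_or_gt a 0 with ha | ha
  · rw [ENNReal.ofReal_of_nonpos ha, ENNReal.log_zero, EReal.coe_mul_bot_of_neg (by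
      simpa using hn)]
    exact le_top
  · rw [ENNReal.log_ofReal_of_pos ha, ← EReal.coe_mul, EReal.coe_le_coe_iff]
    have := (Real.log_le_iff_le_exp ha).2 h
    have h2 : (1 / (n : ℝ)) * (n * s) = s := by field_simp
    have h3 := mul_le_mul_of_nonneg_left this (show (0 : ℝ) ≤ 1 / n by positivity)
    linarith

theorem neg_inv_mul_log_le {a s : ℝ} (hn : 0 < n) (h : Real.exp (-(n * s)) ≤ a) :
    ((-(1 / (n : ℝ)) : ℝ) : EReal) * ENNReal.log (ENNReal.ofReal a) ≤ s := by
  have hn' : (0 : ℝ) < n := by exact_mod_cast hn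
  have ha := (Real.exp_pos _).trans_le h
  rw [ENNReal.log_ofReal_of_pos ha, ← EReal.coe_mul, EReal.coe_le_coe_iff]
  have := (Real.le_log_iff_exp_le ha).2 h
  have h2 : (1 / (n : ℝ)) * (n * s) = s := by field_simp
  have h3 := mul_le_mul_of_nonneg_left this (show (0 : ℝ) ≤ 1 / n by positivity)
  linarith

theorem eventually_blocklengths (P : X → ℝ) :
    ∀ᶠ n : ℕ in blocklengths P, 0 < n ∧ (typeClass P n).Nonempty :=
  ((eventually_gt_atTop 0).filter_mono inf_le_left).and
    ((eventually_principal.2 fun _ h => h).filter_mono inf_le_right)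

theorem le_decayExponent {a : ℕ → ℝ} {V : ℝ}
    (h : ∀ s < V, ∀ᶠ n : ℕ in blocklengths P, a n ≤ Real.exp (-(n * s))) :
    (V : EReal) ≤ decayExponent P a := by
  refine EReal.ge_of_forall_gt_iff_ge.1 fun s hs => ?_
  refine le_liminf_of_le (h := ?_)
  filter_upwards [h s (by exact_mod_cast hs), eventually_blocklengths P] with n h1 h2
  exact le_neg_inv_mul_log h2.1 h1

theorem decayExponent_le {a : ℕ → ℝ} {V : ℝ}
    (h : ∀ s > V, ∃ᶠ n : ℕ in blocklengths P, Real.exp (-(n * s)) ≤ a n) :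
    decayExponent P a ≤ (V : EReal) := by
  refine EReal.le_of_forall_lt_iff_le.1 fun s hs => ?_
  refine liminf_le_of_frequently_le' ?_
  refine ((h s (by exact_mod_cast hs)).and_eventually (eventually_blocklengths P)).mono ?_
  rintro n ⟨h1, h2⟩
  exact neg_inv_mul_log_le h2.1 h1

theorem eventually_lt_of_le_decayExponent {a : ℕ → ℝ} {E s : ℝ}
    (h : (E : EReal) ≤ decayExponent P a) (hs : s < E) :
    ∀ᶠ n : ℕ in blocklengths P, a n < Real.exp (-(n * s)) := by
  have h1 : (s : EReal) < decayExponent P a := lt_of_lt_of_le (by exact_mod_cast hs) h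
  filter_upwards [eventually_lt_of_lt_liminf h1, eventually_blocklengths P] with n h2 h3
  by_contra! h4
  exact absurd (neg_inv_mul_log_le h3.1 h4) (not_le.2 h2)

theorem decayExponent_mono {a b : ℕ → ℝ} (h : ∀ᶠ n : ℕ in blocklengths P, a n ≤ b n) :
    decayExponent P b ≤ decayExponent P a := by
  refine liminf_le_liminf ?_
  filter_upwards [h, eventually_blocklengths P] with n h1 h2
  rw [EReal.coe_neg, EReal.neg_mul, EReal.neg_mul]
  refine EReal.neg_le_neg_iff.2 (mul_le_mul_of_nonneg_left
    (ENNReal.log_le_log (ENNReal.ofReal_le_ofReal h1)) ?_)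
  exact_mod_cast (by positivity : (0 : ℝ) ≤ 1 / n)

theorem decayExponent_eq_top {a : ℕ → ℝ} (h : ∀ᶠ n : ℕ in blocklengths P, a n ≤ 0) :
    decayExponent P a = ⊤ := by
  refine top_le_iff.1 (EReal.ge_of_forall_gt_iff_ge.1 fun s _ => ?_)
  refine le_liminf_of_le (h := ?_)
  filter_upwards [h, eventually_blocklengths P] with n h1 h2
  exact le_neg_inv_mul_log h2.1 (h1.trans (Real.exp_nonneg _))

theorem eventually_mul_polyLog_le (c : ℝ) {ε : ℝ} (hε : 0 < ε) :
    ∀ᶠ n : ℕ in atTop, c * polyLog n ≤ n * ε := by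
  have h1 : Tendsto (fun n : ℕ => (n : ℝ) + 1) atTop atTop :=
    tendsto_natCast_atTop_atTop.atTop_add tendsto_const_nhds
  have h2 : (fun n : ℕ => Real.log ((n : ℝ) + 1)) =o[atTop] fun n : ℕ => (n : ℝ) + 1 :=
    Real.isLittleO_log_id_atTop.comp_tendsto h1
  -- With this constant `|c| log (n + 1) ≤ ε (n + 1) / 2`; the rest, `|c| + ε / 2`, is at most `n ε
  -- / 2` once `n ≥ 2 (|c| + ε) / ε`.
  have hd : 0 < ε / (2 * (|c| + 1)) := by positivity
  filter_upwards [h2.bound hd, tendsto_natCast_atTop_atTop.eventually_ge_atTop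
    (2 * (|c| + ε) / ε)] with n hn1 hn2
  rw [Real.norm_eq_abs, Real.norm_eq_abs, abs_of_nonneg (by positivity : (0 : ℝ) ≤ n + 1)] at hn1
  have hn3 := (le_abs_self _).trans hn1
  have hn4 : 2 * (|c| + ε) ≤ n * ε := by rwa [div_le_iff₀ hε] at hn2
  have h5 : |c| * (ε / (2 * (|c| + 1)) * (n + 1)) ≤ ε / 2 * (n + 1) := by
    rw [← mul_assoc]
    refine mul_le_mul_of_nonneg_right ?_ (by positivity)
    rw [mul_div_assoc', div_le_div_iff₀ (by positivity) (by norm_num)]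
    nlinarith [abs_nonneg c]
  have h6 : c * polyLog n ≤ |c| * polyLog n :=
    mul_le_mul_of_nonneg_right (le_abs_self c) (polyLog_nonneg n)
  have h7 := mul_le_mul_of_nonneg_left hn3 (abs_nonneg c)
  unfold polyLog at h6 ⊢
  nlinarith

theorem eventually_le_exp_mul (b : ℝ) {ε : ℝ} (hε : 0 < ε) :
    ∀ᶠ n : ℕ in atTop, b ≤ Real.exp (n * ε) :=
  (Real.tendsto_exp_atTop.comp
    (tendsto_natCast_atTop_atTop.atTop_mul_const hε)).eventually_ge_atTop b

theorem numCodewords_le (R : ℝ) (n : ℕ) : (numCodewords R n : ℝ) ≤ Real.exp (n * R) :=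
  Nat.floor_le (Real.exp_nonneg _)

theorem numCodewords_le_one {R : ℝ} (hR : R ≤ 0) (n : ℕ) : numCodewords R n ≤ 1 := by
  refine Nat.floor_le_one_of_le_one ?_
  rw [Real.exp_le_one_iff]
  exact mul_nonpos_of_nonneg_of_nonpos n.cast_nonneg hR

/-- Rounding and the removed codeword cost at most `2`, which is half of `4`. -/
theorem le_numCodewords_sub_one {R : ℝ} (h : 4 ≤ Real.exp (n * R)) :
    Real.exp (n * R) / 2 ≤ (numCodewords R n : ℝ) - 1 := by
  have := (Nat.lt_floor_add_one (Real.exp (n * R))).le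
  unfold numCodewords
  linarith

/-- A joint type of divergence at most `E` competes in the minimum defining `g^*`, so its likelihood
reaches the threshold. Only types of divergence above `E` cause errors. -/
theorem le_errorExponent_optimal (hW : ∀ x, W x ∈ stdSimplex ℝ Y) (R E : ℝ) :
    (E : EReal) ≤ errorExponent P W R
      (outputThresholdDecoder W (optimalOutputThreshold P W E)) := by
  classical
  refine le_decayExponent fun s hs => ?_
  filter_upwards [eventually_blocklengths P, (eventually_mul_polyLog_le (typeConst X Y)
    (sub_pos.2 hs)).filter_mono inf_le_left] with n hn hpoly
  refine (ensembleAvg_errorProb_output_le hW hn.2 _).trans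
    ((expect_vecProb_le hn.1 hW hn.2 (B := Real.exp (-(n * E))) (ω := fun Q =>
      if optimalOutputThreshold P W E (margY Q) ≤ logLik W Q then 0 else 1)
      (Real.exp_nonneg _) ?_).trans ?_)
  · intro x hx y hadm
    split_ifs with h
    · simpa using Real.exp_nonneg _
    · rw [mul_one, Real.exp_le_exp, neg_le_neg_iff]
      refine mul_le_mul_of_nonneg_left ?_ n.cast_nonneg
      by_contra! hlt
      refine h ?_
      rw [logLik_eq_coe hW hadm.2]
      exact optimalOutputThreshold_le hW ⟨hadm, hlt.le⟩
  · rw [← Real.exp_add, Real.exp_le_exp]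
    linarith

/-- A union bound over the joint types of the transmitted and the wrong codeword; `V` bounds the
exponent of every pair that puts the wrong one on the list. -/
theorem le_listExponent_optimal (hW : ∀ x, W x ∈ stdSimplex ℝ Y) (R : ℝ) {E V : ℝ}
    (hV : ∀ Q₁ ∈ admissible P W, ∀ Q₂ ∈ admissible P W, margY Q₂ = margY Q₁ →
      optimalOutputThreshold P W E (margY Q₂) ≤ logLik W Q₂ →
      V ≤ divR P W Q₁ + mutualInfo Q₂) :
    ((V - R : ℝ) : EReal) ≤ listExponent P W R
      (outputThresholdDecoder W (optimalOutputThreshold P W E)) := by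
  classical
  refine le_decayExponent fun s hs => ?_
  filter_upwards [eventually_blocklengths P, (eventually_mul_polyLog_le (2 * typeConst X Y)
    (sub_pos.2 hs)).filter_mono inf_le_left] with n hn hpoly
  set g := optimalOutputThreshold P W E with hg
  obtain ⟨G, -, -, -, hG, hG'⟩ := isThreshold_optimalOutputThreshold (P := P) (E := E) hW
  -- Since the threshold is never `⊥`, a listed codeword has a likelihood other than `⊥`, so its
  -- joint type is admissible.
  have hgbot : ∀ q, g q ≠ ⊥ := fun q => by
    by_cases hq : q ∈ G
    · exact (hG q hq).1
    · rw [hg, hG' q hq]; exact top_ne_bot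
  have h1 : ∀ x ∈ typeClass P n, (∑ y, vecProb W x y * 𝔼 x' ∈ typeClass P n,
      if g (empDist y) ≤ logLik W (jointEmpDist x' y) then (1 : ℝ) else 0) ≤
      ∑ y, vecProb W x y * (Real.exp (typeConst X Y * polyLog n) *
        Real.exp (-(n * (V - divR P W (jointEmpDist x y))))) := by
    intro x hx
    refine Finset.sum_le_sum fun y _ => ?_
    rcases eq_or_ne (vecProb W x y) 0 with h0 | h0
    · simp [h0]
    refine mul_le_mul_of_nonneg_left ?_ (vecProb_nonneg hW x y)
    have hadm : jointEmpDist x y ∈ admissible P W :=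
      ⟨jointEmpDist_mem_jointDist hn.1 hx y, supp_of_vecProb_ne_zero h0⟩
    refine expect_indicator_le hn.1 hn.2 y
      (Φ := fun Q => g (empDist y) ≤ logLik W Q) (Real.exp_nonneg _) fun x' hx' hle => ?_
    have hadm' : jointEmpDist x' y ∈ admissible P W :=
      ⟨jointEmpDist_mem_jointDist hn.1 hx' y, eq_zero_of_logLik_ne_bot (empDist_nonneg _)
        fun hb => hgbot (empDist y) (le_bot_iff.1 (hb ▸ hle))⟩
    have := hV _ hadm _ hadm' (by rw [margY_jointEmpDist, margY_jointEmpDist])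
      (by rw [margY_jointEmpDist]; exact hle)
    rw [Real.exp_le_exp, neg_le_neg_iff]
    exact mul_le_mul_of_nonneg_left (by linarith) n.cast_nonneg
  -- The weight `exp(n D)` from the inner bound cancels the probability `exp(-n D)` of the
  -- transmitted type, leaving `exp(-n V)` for every type.
  have h2 := expect_vecProb_le hn.1 hW hn.2 (ω := fun Q =>
    Real.exp (typeConst X Y * polyLog n) * Real.exp (-(n * (V - divR P W Q))))
    (B := Real.exp (typeConst X Y * polyLog n) * Real.exp (-(n * V))) (by positivity) (by
      intro x _ y _
      refine le_of_eq ?_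
      rw [mul_left_comm, ← Real.exp_add]
      congr 2; ring)
  refine (ensembleAvg_listSize_output_le hW hn.2 _).trans ?_
  refine (mul_le_mul (numCodewords_le R n) ((Finset.expect_le_expect h1).trans h2)
    (Finset.expect_nonneg fun x _ => Finset.sum_nonneg fun y _ => mul_nonneg
      (vecProb_nonneg hW x y) (Finset.expect_nonneg fun x' _ => by split_ifs <;> norm_num))
    (Real.exp_nonneg _)).trans ?_
  rw [← Real.exp_add, ← Real.exp_add, ← Real.exp_add, Real.exp_le_exp]
  nlinarith

/-! ### Converse bounds along types -/

theorem half_le_one_sub_pow {u ρ : ℝ} {k : ℕ} (hu : 0 ≤ u) (hu1 : u ≤ 1) (hρ1 : ρ ≤ 1)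
    (h : u ≤ ρ * k) : u / 2 ≤ 1 - (1 - ρ) ^ k := by
  have h1 : (1 - ρ) ^ k ≤ Real.exp (-u) := by
    calc (1 - ρ) ^ k ≤ Real.exp (-ρ) ^ k :=
          pow_le_pow_left₀ (by linarith) (Real.one_sub_le_exp_neg ρ) k
      _ = Real.exp (-(ρ * k)) := by rw [← Real.exp_nat_mul]; congr 1; ring
      _ ≤ Real.exp (-u) := Real.exp_le_exp.2 (by linarith)
  -- This follows from `(1 + u) (1 - u / 2) ≥ 1`, valid for `0 ≤ u ≤ 1`.
  have h2 : Real.exp (-u) ≤ 1 - u / 2 := by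
    rw [Real.exp_neg, inv_le_iff_one_le_mul₀ (Real.exp_pos u)]
    have := Real.add_one_le_exp u
    nlinarith
  linarith

theorem jointTypeProb_le_one (hT : (typeClass P n).Nonempty) (Q : X × Y → ℝ) (y : Fin n → Y) :
    jointTypeProb P Q y ≤ 1 := by
  unfold jointTypeProb
  refine Finset.expect_le hT fun x _ => ?_
  split_ifs <;> norm_num

/-- The joint threshold is at most the log-likelihood of a joint type of divergence below the error
exponent, on the joint types that occur among the wrong codewords. -/
theorem threshold_le_of_errorProb_lt (hn : 0 < n) (hW : ∀ x, W x ∈ stdSimplex ℝ Y) {R E δ η : ℝ}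
    {h : (X × Y → ℝ) → EReal} {x₁ : Fin n → X} {y₁ : Fin n → Y}
    (hQ : jointEmpDist x₁ y₁ ∈ admissible P W) (hδ : 0 ≤ δ) (hη : 0 < η)
    (hE : divR P W (jointEmpDist x₁ y₁) + 2 * δ + 3 * η ≤ E)
    (hpoly : typeConst X Y * polyLog n ≤ n * η) (h4 : 4 ≤ Real.exp (n * η))
    (hR4 : 4 ≤ Real.exp (n * R))
    (herr : ensembleAvg P n (numCodewords R n)
      (fun C => errorProb W (jointThresholdDecoder W h) C) < Real.exp (-(n * (E - δ))))
    {x : Fin n → X} (hx : x ∈ typeClass P n) {y : Fin n → Y} (hy : empDist y = empDist y₁)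
    (hI : mutualInfo (jointEmpDist x y) ≤ R + δ) :
    h (jointEmpDist x y) ≤ (llr W (jointEmpDist x₁ y₁) : EReal) := by
  by_contra! hlt
  have hn' : (0 : ℝ) < n := by exact_mod_cast hn
  obtain ⟨x₂, hx₂, he⟩ := exists_jointEmpDist_eq hx hy.symm
  rw [← he] at hlt hI
  set M := numCodewords R n with hM
  have hM1 : Real.exp (n * R) / 2 ≤ (M : ℝ) - 1 := le_numCodewords_sub_one hR4
  have hM0 : 0 < M := by
    have : (0 : ℝ) < M := by linarith
    exact_mod_cast this
  have hlow := le_ensembleAvg_errorProb_joint hn hM0 hW hQ hx₂ hlt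
  set ρ := Real.exp (-(n * mutualInfo (jointEmpDist x₂ y₁)) - typeConst X Y * polyLog n) with hρ
  have hρ1 : ρ ≤ 1 := (le_jointTypeProb hn hx₂ y₁).trans (jointTypeProb_le_one ⟨x₂, hx₂⟩ _ _)
  have hρ2 : Real.exp (-(n * (R + δ + η))) ≤ ρ := by
    rw [hρ, Real.exp_le_exp]
    nlinarith
  -- The expected number of competitors of the offending type is at least about `exp(-n (δ + η)) /
  -- 2`. In `hE` one `δ` is the excess of `I` over `R` and the other the gap in the error bound; the
  -- three `η` pay for two polynomial factors and the constant `4`.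
  have hu : Real.exp (-(n * (δ + η))) / 2 ≤ ρ * (M - 1 : ℕ) := by
    rw [Nat.cast_sub hM0, Nat.cast_one]
    calc _ = Real.exp (-(n * (R + δ + η))) * (Real.exp (n * R) / 2) := by
          rw [mul_div_assoc', ← Real.exp_add]; congr 2; ring
      _ ≤ _ := by gcongr
  have hu1 : Real.exp (-(n * (δ + η))) ≤ 1 := by
    rw [Real.exp_le_one_iff]; nlinarith
  have h5 := half_le_one_sub_pow (by positivity) (by linarith) hρ1 hu
  have h6 : Real.exp (-(n * (δ + 2 * η))) ≤ Real.exp (-(n * (δ + η))) / 2 / 2 := by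
    have : Real.exp (-(n * (δ + η))) = Real.exp (-(n * (δ + 2 * η))) * Real.exp (n * η) := by
      rw [← Real.exp_add]; congr 1; ring
    rw [this]
    nlinarith [Real.exp_pos (-(n * (δ + 2 * η)))]
  have h7 : Real.exp (-(n * (E - δ))) ≤
      Real.exp (-(n * divR P W (jointEmpDist x₁ y₁)) - typeConst X Y * polyLog n) *
        (1 - (1 - ρ) ^ (M - 1)) := by
    calc _ ≤ Real.exp (-(n * divR P W (jointEmpDist x₁ y₁)) - typeConst X Y * polyLog n) *
          Real.exp (-(n * (δ + 2 * η))) := by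
          rw [← Real.exp_add, Real.exp_le_exp]
          nlinarith
      _ ≤ _ := mul_le_mul_of_nonneg_left (h6.trans h5) (Real.exp_nonneg _)
  linarith

theorem exists_empDist_mul {α : Type*} [Fintype α] [DecidableEq α] {N : ℕ} (z : Fin N → α)
    {j : ℕ} (hj : 0 < j) : ∃ z' : Fin (j * N) → α, empDist z' = empDist z := by
  obtain ⟨z', hz'⟩ := exists_empDist_eq (fun a => j * letterCount z a) (N := j * N)
    (by rw [← Finset.mul_sum, sum_letterCount])
  refine ⟨z', ?_⟩
  ext a
  rw [hz', empDist_apply]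
  have : (j : ℝ) ≠ 0 := by positivity
  push_cast
  rw [mul_div_mul_left _ _ this]

/-- A type of length `N` is a type at every multiple of `N`; bounding a `liminf` from above needs
only these infinitely many blocklengths. -/
theorem frequently_blocklengths {N : ℕ} (hN : 0 < N) {z : Fin N → X × Y}
    (hz : margX (empDist z) = P) :
    ∃ᶠ n : ℕ in blocklengths P, ∃ j, 0 < j ∧ n = j * N := by
  rw [blocklengths, frequently_inf_principal, frequently_atTop]
  intro a
  refine ⟨(a + 1) * N, by nlinarith, ?_, a + 1, Nat.succ_pos a, rfl⟩
  obtain ⟨z', hz'⟩ := exists_empDist_mul z (Nat.succ_pos a)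
  refine ⟨fun i => (z' i).1, mem_typeClass.2 ?_⟩
  rw [← margX_jointEmpDist _ fun i => (z' i).2, ← hz, ← hz']
  rfl

/-- By `hthr`, a codeword that blocks the wrong one has mutual information above `R + δ`. The
expected number of such codewords is small, so with probability at least one half there are none. -/
theorem le_listSize_of_threshold_le (hn : 0 < n) (hW : ∀ x, W x ∈ stdSimplex ℝ Y)
    {R δ η : ℝ} {h : (X × Y → ℝ) → EReal} {x₁ x₂ : Fin n → X} {y₁ : Fin n → Y}
    (hQ : jointEmpDist x₁ y₁ ∈ admissible P W) (hx₂ : x₂ ∈ typeClass P n)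
    (hQ₂ : ∀ a b, W a b = 0 → jointEmpDist x₂ y₁ (a, b) = 0) (hηδ : η ≤ δ / 2)
    (hI : mutualInfo (jointEmpDist x₁ y₁) ≤ R + δ)
    (hpoly : typeConst X Y * polyLog n ≤ n * η) (h4 : 4 ≤ Real.exp (n * η))
    (hR4 : 4 ≤ Real.exp (n * R))
    (hthr : ∀ x ∈ typeClass P n, ∀ y : Fin n → Y, empDist y = empDist y₁ →
      mutualInfo (jointEmpDist x y) ≤ R + δ →
      h (jointEmpDist x y) ≤ (llr W (jointEmpDist x₂ y₁) : EReal)) :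
    Real.exp (-(n * (divR P W (jointEmpDist x₁ y₁) + mutualInfo (jointEmpDist x₂ y₁) - R +
      3 * η))) ≤ ensembleAvg P n (numCodewords R n)
        (fun C => listSize W (jointThresholdDecoder W h) C) := by
  classical
  have hT : (typeClass P n).Nonempty := ⟨x₂, hx₂⟩
  have hx₁ : x₁ ∈ typeClass P n := by
    rw [mem_typeClass, ← margX_jointEmpDist x₁ y₁, hQ.1.2]
  set D := divR P W (jointEmpDist x₁ y₁) with hD
  set I := mutualInfo (jointEmpDist x₂ y₁) with hIdef
  set M := numCodewords R n with hM
  have hM1 : Real.exp (n * R) / 2 ≤ (M : ℝ) - 1 := le_numCodewords_sub_one hR4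
  have hM0 : 0 < M := by
    have : (0 : ℝ) < M := by linarith
    exact_mod_cast this
  have hn' : (0 : ℝ) < n := by exact_mod_cast hn
  -- `β` bounds the chance that one codeword blocks. As `η ≤ δ / 2`, `β exp(n R) ≤ exp(-n η) ≤ 1 /
  -- 4`, and Bernoulli's inequality then gives `h8`.
  set β := Real.exp (typeConst X Y * polyLog n) * Real.exp (-(n * (R + δ))) with hβ
  have h4' : Real.exp (-(n * η)) ≤ 1 / 4 := by
    rw [Real.exp_neg, one_div]
    exact inv_anti₀ (by norm_num) h4
  have hβ2 : β * Real.exp (n * R) ≤ 1 / 4 := by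
    refine le_trans ?_ h4'
    rw [hβ, ← Real.exp_add, ← Real.exp_add, Real.exp_le_exp]
    nlinarith
  have hβ0 : 0 < β := mul_pos (Real.exp_pos _) (Real.exp_pos _)
  have hβ1 : β ≤ 1 / 4 := by nlinarith
  have hlow := le_ensembleAvg_listSize_joint hn hM0 hW (h := h) (x₁ := x₁) (x₂ := x₂) (y₁ := y₁)
    hQ hx₂ hQ₂ (hthr x₁ hx₁ y₁ rfl hI) (β := β) (by linarith) (by
      intro y hy
      refine expect_indicator_le hn hT y
        (Φ := fun Q => ¬ h Q ≤ (llr W (jointEmpDist x₂ y₁) : EReal))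
        (Real.exp_nonneg _) fun x hx hnot => ?_
      rw [Real.exp_le_exp, neg_le_neg_iff]
      refine mul_le_mul_of_nonneg_left ?_ hn'.le
      by_contra! hlt
      exact hnot (hthr x hx y hy hlt.le))
  refine le_trans ?_ hlow
  have h8 : 1 / 2 ≤ (1 - β) ^ (M - 2) := by
    have h9 := one_add_mul_le_pow (show (-2 : ℝ) ≤ -β by linarith) (M - 2)
    rw [← sub_eq_add_neg] at h9
    have h10 : ((M - 2 : ℕ) : ℝ) ≤ Real.exp (n * R) :=
      (Nat.cast_le.2 (Nat.sub_le M 2)).trans (numCodewords_le R n)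
    nlinarith
  rw [← hD, ← hIdef]
  calc Real.exp (-(n * (D + I - R + 3 * η)))
      = Real.exp (-(n * (D + I - R + 2 * η))) * Real.exp (-(n * η)) := by
        rw [← Real.exp_add]; congr 1; ring
    _ ≤ Real.exp (-(n * (D + I - R + 2 * η))) * (1 / 4) :=
        mul_le_mul_of_nonneg_left h4' (Real.exp_nonneg _)
    _ = Real.exp (n * R) / 2 * (Real.exp (-(n * D) - n * η) *
          (Real.exp (-(n * I) - n * η) * (1 / 2))) := by
        have : Real.exp (-(n * (D + I - R + 2 * η))) = Real.exp (n * R) *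
            (Real.exp (-(n * D) - n * η) * Real.exp (-(n * I) - n * η)) := by
          rw [← Real.exp_add, ← Real.exp_add]; congr 1; ring
        rw [this]; ring
    _ ≤ _ := by
        refine mul_le_mul hM1 ?_ (by positivity) (by linarith [Real.exp_pos (n * R)])
        refine mul_le_mul (Real.exp_le_exp.2 (by linarith)) ?_ (by positivity)
          (Real.exp_nonneg _)
        exact mul_le_mul (Real.exp_le_exp.2 (by linarith)) h8 (by norm_num) (Real.exp_nonneg _)

/-- Here `z`, `z'`, `zt` carry `Q`, `Q'`, `Q̃`. The error requirement at `Q'` bounds the threshold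
by `f(Q') ≤ f(Q)`, and this bound feeds the list size estimate. -/
theorem listExponent_joint_le_of_types (hW : ∀ x, W x ∈ stdSimplex ℝ Y) {R E : ℝ} (hR : 0 < R)
    {h : (X × Y → ℝ) → EReal} {N : ℕ} (hN : 0 < N) {z z' zt : Fin N → X × Y}
    (hQ : empDist z ∈ admissible P W) (hQ' : empDist z' ∈ admissible P W)
    (hQt : empDist zt ∈ admissible P W) (hm' : margY (empDist z') = margY (empDist z))
    (hmt : margY (empDist zt) = margY (empDist z)) (hf : llr W (empDist z') ≤ llr W (empDist z))
    (hD : divR P W (empDist z') < E) (hI : mutualInfo (empDist zt) < R)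
    (hE : (E : EReal) ≤ errorExponent P W R (jointThresholdDecoder W h)) :
    listExponent P W R (jointThresholdDecoder W h) ≤
      ((divR P W (empDist zt) + mutualInfo (empDist z) - R : ℝ) : EReal) := by
  refine decayExponent_le fun s hs => ?_
  -- A quarter of the gap suffices: with `η ≤ δ / 2`, `2 δ + 3 η ≤ 4 δ`.
  obtain ⟨δ, hδ, hδE⟩ : ∃ δ > 0, divR P W (empDist z') + 4 * δ ≤ E :=
    ⟨(E - divR P W (empDist z')) / 4, by linarith, by linarith⟩
  obtain ⟨η, hη, hηδ, hηs⟩ : ∃ η > 0, η ≤ δ / 2 ∧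
      divR P W (empDist zt) + mutualInfo (empDist z) - R + 3 * η ≤ s :=
    ⟨min (δ / 2) ((s - (divR P W (empDist zt) + mutualInfo (empDist z) - R)) / 3),
      lt_min (by linarith) (by linarith), min_le_left _ _, by
        linarith [min_le_right (δ / 2)
          ((s - (divR P W (empDist zt) + mutualInfo (empDist z) - R)) / 3)]⟩
  refine ((frequently_blocklengths hN hQ.1.2).and_eventually
    ((eventually_blocklengths P).and ((eventually_lt_of_le_decayExponent hE
      (show E - δ < E by linarith)).and
      (((eventually_mul_polyLog_le (typeConst X Y) hη).and ((eventually_le_exp_mul 4 hη).and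
        (eventually_le_exp_mul 4 hR))).filter_mono inf_le_left)))).mono ?_
  rintro n ⟨⟨j, hj, hnj⟩, ⟨hn, hT⟩, herr, hpoly, h4, hR4⟩
  have key : ∀ w : Fin N → X × Y, ∃ (x : Fin n → X) (y : Fin n → Y),
      jointEmpDist x y = empDist w := by
    intro w
    obtain ⟨w', hw'⟩ := exists_empDist_mul w hj
    rw [hnj]
    exact ⟨fun i => (w' i).1, fun i => (w' i).2, hw'⟩
  obtain ⟨x₁, y₁, h₁⟩ := key zt
  obtain ⟨x₂', y₂', h₂'⟩ := key z
  obtain ⟨x₃, y₃, h₃⟩ := key z'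
  have hx₂' : x₂' ∈ typeClass P n := by
    rw [mem_typeClass, ← margX_jointEmpDist x₂' y₂', h₂', hQ.1.2]
  have hy₁ : empDist y₁ = margY (empDist z) := by rw [← margY_jointEmpDist x₁, h₁, hmt]
  have hy₂ : empDist y₂' = margY (empDist z) := by rw [← margY_jointEmpDist x₂', h₂']
  have hy₃ : empDist y₃ = margY (empDist z) := by rw [← margY_jointEmpDist x₃, h₃, hm']
  -- Since the output marginals agree, `Q` can be realized with the same output vector as `Q̃`.
  obtain ⟨x₂, hx₂, h₂⟩ := exists_jointEmpDist_eq hx₂' (hy₁.trans hy₂.symm)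
  rw [h₂'] at h₂
  have hthr : ∀ x ∈ typeClass P n, ∀ y : Fin n → Y, empDist y = empDist y₁ →
      mutualInfo (jointEmpDist x y) ≤ R + δ →
      h (jointEmpDist x y) ≤ (llr W (jointEmpDist x₂ y₁) : EReal) := by
    intro x hx y hy hle
    refine (threshold_le_of_errorProb_lt hn hW (x₁ := x₃) (y₁ := y₃) (by rw [h₃]; exact hQ') hδ.le
      hη ?_ hpoly h4 hR4 herr hx (by rw [hy, hy₁, hy₃]) hle).trans ?_
    · rw [h₃]; linarith
    · rw [h₃, h₂]; exact_mod_cast hf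
  have := le_listSize_of_threshold_le hn hW (h := h) (x₁ := x₁) (y₁ := y₁) (by rw [h₁]; exact hQt)
    hx₂ (by rw [h₂]; exact hQ.2) hηδ (by rw [h₁]; linarith) hpoly h4 hR4 hthr
  refine le_trans ?_ this
  rw [h₁, h₂, Real.exp_le_exp, neg_le_neg_iff]
  exact mul_le_mul_of_nonneg_left hηs n.cast_nonneg

end Exponent

/-! ### Rational approximation -/

section Rational

open Topology

/-- Finitely many reals can be approximated by rationals through a `ℚ`-linear map fixing `1`, so
that all rational linear relations between them are kept. -/
theorem exists_ratLinear_approx {ι : Type*} [Finite ι] (v : ι → ℝ) {U : Set (ι → ℝ)}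
    (hU : U ∈ 𝓝 v) : ∃ θ : ℝ →ₗ[ℚ] ℚ, θ 1 = 1 ∧ (fun i => (θ (v i) : ℝ)) ∈ U := by
  set S : Submodule ℚ ℝ := Submodule.span ℚ (insert 1 (Set.range v)) with hS
  have : FiniteDimensional ℚ S :=
    FiniteDimensional.span_of_finite ℚ ((Set.finite_range v).insert 1)
  set b := Module.finBasis ℚ S with hb
  set d := Module.finrank ℚ S with hd
  have h1 : (1 : ℝ) ∈ S := Submodule.subset_span (Set.mem_insert _ _)
  have hv : ∀ i, v i ∈ S := fun i =>
    Submodule.subset_span (Set.mem_insert_of_mem _ (Set.mem_range_self i))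
  -- `L r` is the `ℚ`-linear functional on `S` sending the basis to `r`. At `r = e` it is the
  -- inclusion into `ℝ`; a nearby rational `r`, normalized by its value at `1`, gives the
  -- approximation.
  set L : (Fin d → ℝ) → S → ℝ := fun r u => ∑ j, r j * ((b.repr u j : ℚ) : ℝ) with hL
  have hLc : ∀ u, Continuous fun r => L r u := fun u => by
    simp only [hL]; fun_prop
  set e : Fin d → ℝ := fun j => (b j : ℝ) with he
  have hLe : ∀ u : S, L e u = u := by
    intro u
    have := congrArg (fun w : S => (w : ℝ)) (b.sum_repr u)
    simp only [Submodule.coe_sum, Submodule.coe_smul] at this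
    rw [← this]
    refine Finset.sum_congr rfl fun j _ => ?_
    rw [Rat.smul_def, mul_comm]
  have hdense : DenseRange fun r : Fin d → ℚ => fun j => (r j : ℝ) :=
    DenseRange.piMap fun _ => Rat.denseRange_cast
  have hcont : ContinuousAt (fun r => fun i => L r ⟨v i, hv i⟩ / L r ⟨1, h1⟩) e := by
    refine continuousAt_pi.2 fun i => ?_
    exact (hLc _).continuousAt.div (hLc _).continuousAt (by rw [hLe]; norm_num)
  have hval : (fun i => L e ⟨v i, hv i⟩ / L e ⟨1, h1⟩) = v := by
    ext i; rw [hLe, hLe]; simp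
  have hmem : {r : Fin d → ℝ | (fun i => L r ⟨v i, hv i⟩ / L r ⟨1, h1⟩) ∈ U ∧
      L r ⟨1, h1⟩ ≠ 0} ∈ 𝓝 e := by
    refine inter_mem (hcont.preimage_mem_nhds (by rw [hval]; exact hU)) ?_
    exact (hLc _).continuousAt.eventually_ne (by rw [hLe]; norm_num)
  obtain ⟨r, hr1, hr2⟩ := hdense.exists_mem_open isOpen_interior
    ⟨e, mem_interior_iff_mem_nhds.2 hmem⟩ |>.imp fun r hr => interior_subset hr
  set ψ : S →ₗ[ℚ] ℚ := b.constr ℚ r with hψ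
  have hψL : ∀ u : S, ((ψ u : ℚ) : ℝ) = L (fun j => (r j : ℝ)) u := by
    intro u
    rw [hψ, Module.Basis.constr_apply_fintype]
    simp only [hL, smul_eq_mul, Rat.cast_sum, Rat.cast_mul, Module.Basis.equivFun_apply]
    exact Finset.sum_congr rfl fun j _ => mul_comm _ _
  have hψ1 : ψ ⟨1, h1⟩ ≠ 0 := by
    intro h0
    apply hr2
    rw [← hψL, h0, Rat.cast_zero]
  obtain ⟨θ, hθ⟩ := LinearMap.exists_extend ((ψ ⟨1, h1⟩)⁻¹ • ψ)
  have hθS : ∀ u : S, θ u = (ψ ⟨1, h1⟩)⁻¹ * ψ u := fun u => LinearMap.congr_fun hθ u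
  refine ⟨θ, ?_, ?_⟩
  · rw [hθS ⟨1, h1⟩, inv_mul_cancel₀ hψ1]
  · convert hr1 using 1
    ext i
    rw [hθS ⟨v i, hv i⟩]
    push_cast
    rw [hψL, hψL, inv_mul_eq_div]

theorem exists_common_denominator {ι : Type*} [Fintype ι] (w : ι → ℚ) (hw : ∀ i, 0 ≤ w i) :
    ∃ N : ℕ, 0 < N ∧ ∃ k : ι → ℕ, ∀ i, (k i : ℚ) = w i * N := by
  classical
  refine ⟨∏ i, (w i).den, Finset.prod_pos fun i _ => (w i).den_pos,
    fun i => (w i).num.toNat * ∏ j ∈ Finset.univ.erase i, (w j).den, fun i => ?_⟩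
  rw [← Finset.mul_prod_erase _ _ (Finset.mem_univ i)]
  push_cast
  rw [← mul_assoc, Rat.mul_den_eq_num]
  congr 1
  have : (((w i).num.toNat : ℤ) : ℚ) = ((w i).num : ℚ) := by
    rw [Int.toNat_of_nonneg (Rat.num_nonneg.2 (hw i))]
  exact_mod_cast this

variable {X Y : Type*} [Fintype X] [DecidableEq X] [Fintype Y] [DecidableEq Y]
  {P : X → ℝ} {W : X → Y → ℝ}

/-- Admissible distributions with a common `Y`-marginal can be approximated simultaneously by
joint types of the same kind. -/
theorem exists_types_mem_nhds {κ : Type*} [Finite κ] (hP : ∃ n : ℕ, 0 < n ∧ (typeClass P n).Nonempty)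
    (Q : κ → X × Y → ℝ) (hQ : ∀ i, Q i ∈ admissible P W)
    (hm : ∀ i j, margY (Q i) = margY (Q j)) {U : Set (κ → X × Y → ℝ)} (hU : U ∈ 𝓝 Q) :
    ∃ N : ℕ, 0 < N ∧ ∃ z : κ → Fin N → X × Y, (fun i => empDist (z i)) ∈ U ∧
      (∀ i, empDist (z i) ∈ admissible P W) ∧
      ∀ i j, margY (empDist (z i)) = margY (empDist (z j)) := by
  have := Fintype.ofFinite κ
  set v : κ × (X × Y) → ℝ := fun p => Q p.1 p.2 with hv
  have hcurry : Continuous fun w : κ × (X × Y) → ℝ => fun i a => w (i, a) := by fun_prop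
  have hU1 : (fun w : κ × (X × Y) → ℝ => fun i a => w (i, a)) ⁻¹' U ∈ 𝓝 v :=
    hcurry.continuousAt.preimage_mem_nhds hU
  -- Positive entries stay positive near `v`, and zero entries are kept exactly by linearity, so the
  -- approximations are nonnegative.
  have hU2 : {w : κ × (X × Y) → ℝ | ∀ p, 0 < v p → 0 < w p} ∈ 𝓝 v := by
    refine eventually_all.2 fun p => ?_
    by_cases hp : 0 < v p
    · exact ((continuous_apply p).continuousAt.eventually (lt_mem_nhds hp)).mono fun w hw _ => hw
    · exact Eventually.of_forall fun w hw => absurd hw hp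
  obtain ⟨θ, hθ1, hθU, hθpos⟩ := exists_ratLinear_approx v (inter_mem hU1 hU2)
  have hθ0 : ∀ p, 0 ≤ θ (v p) := by
    intro p
    rcases ((hQ p.1).1.1.1 p.2).eq_or_lt with h | h
    · have : v p = 0 := h.symm
      rw [this, map_zero]
    · have : (0 : ℝ) < θ (v p) := hθpos p h
      exact_mod_cast this.le
  obtain ⟨N, hN, k, hk⟩ := exists_common_denominator (fun p => θ (v p)) hθ0
  have hsum : ∀ i, ∑ a, k (i, a) = N := by
    intro i
    have h1 : ∑ a, ((k (i, a) : ℕ) : ℚ) = N := by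
      simp only [hk, ← Finset.sum_mul, ← map_sum]
      have : ∑ a, v (i, a) = 1 := (hQ i).1.1.2
      rw [this, hθ1, one_mul]
    exact_mod_cast h1
  choose z hz using fun i => exists_empDist_eq (fun a => k (i, a)) (hsum i)
  have hNR : (N : ℝ) ≠ 0 := by positivity
  have hzθ : ∀ i a, empDist (z i) a = (θ (Q i a) : ℝ) := by
    intro i a
    rw [hz, div_eq_iff hNR]
    exact_mod_cast hk (i, a)
  obtain ⟨n, hn, x, hx⟩ := hP
  -- Being a type, `P` has rational entries, which `θ` fixes.
  have hPθ : ∀ a, ((θ (P a) : ℚ) : ℝ) = P a := by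
    intro a
    have h1 : P a = (((letterCount x a : ℚ) / n : ℚ) : ℝ) := by
      rw [← mem_typeClass.1 hx, empDist_apply]; push_cast; rfl
    have h2 : θ (((letterCount x a : ℚ) / n : ℚ) : ℝ) = (letterCount x a : ℚ) / n := by
      have := θ.map_smul ((letterCount x a : ℚ) / n) (1 : ℝ)
      rw [Rat.smul_def, mul_one, hθ1, smul_eq_mul, mul_one] at this
      exact this
    rw [h1, h2]
  refine ⟨N, hN, z, ?_, fun i => ⟨⟨empDist_mem_stdSimplex hN _, ?_⟩, fun x y hxy => ?_⟩,
    fun i j => ?_⟩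
  · rw [show (fun i => empDist (z i)) = fun i a => (θ (v (i, a)) : ℝ) from
      funext fun i => funext fun a => hzθ i a]
    exact hθU
  · ext a
    rw [← hPθ a, ← (hQ i).1.2]
    simp only [margX, hzθ, map_sum, Rat.cast_sum]
  · rw [hzθ, (hQ i).2 x y hxy, map_zero, Rat.cast_zero]
  · ext b
    have := congrArg (fun q : Y → ℝ => ((θ (q b) : ℚ) : ℝ)) (hm i j)
    simpa only [margY, hzθ, map_sum, Rat.cast_sum] using this

end Rational

/-! ### The converse bound for joint threshold decoders -/

section Converse

open Topology

variable {X Y : Type*} [Fintype X] [DecidableEq X] [Fintype Y] [DecidableEq Y]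
  {P : X → ℝ} {W : X → Y → ℝ}

/-- Strict inequalities pass to nearby types by continuity. Equality of likelihoods need not, since
`log W` is irrational in general; hence `hf` asks for a strict inequality or for a likelihood
determined by the output marginal. -/
theorem listExponent_joint_le (hP : ∃ n : ℕ, 0 < n ∧ (typeClass P n).Nonempty)
    (hW : ∀ x, W x ∈ stdSimplex ℝ Y) {R E : ℝ} (hR : 0 < R)
    {h : (X × Y → ℝ) → EReal} {Q Q' Qt : X × Y → ℝ}
    (hQ : Q ∈ admissible P W) (hQ' : Q' ∈ admissible P W)
    (hQt : Qt ∈ admissible P W) (hm' : margY Q' = margY Q) (hmt : margY Qt = margY Q)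
    (hf : llr W Q' < llr W Q ∨ ∀ A ∈ admissible P W, ∀ B ∈ admissible P W, margY A = margY B →
      llr W A = llr W B)
    (hD : divR P W Q' < E) (hI : mutualInfo Qt < R)
    (hE : (E : EReal) ≤ errorExponent P W R (jointThresholdDecoder W h)) :
    listExponent P W R (jointThresholdDecoder W h) ≤
      ((divR P W Qt + mutualInfo Q - R : ℝ) : EReal) := by
  refine EReal.le_of_forall_lt_iff_le.1 fun s hs => ?_
  have hs' : divR P W Qt + mutualInfo Q - R < s := by exact_mod_cast hs
  -- This entropy form is continuous everywhere and equals `mutualInfo` on nonnegative functions.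
  set mi : (X × Y → ℝ) → ℝ := fun Q => ent (margX Q) + ent (margY Q) - ent Q with hmi
  have hmic : Continuous mi := ((continuous_ent.comp continuous_margX).add
    (continuous_ent.comp continuous_margY)).sub continuous_ent
  set T : Fin 3 → X × Y → ℝ := ![Q, Q', Qt] with hT
  have hp : ∀ i, Continuous fun w : Fin 3 → X × Y → ℝ => w i := fun i => continuous_apply i
  have h1 : ∀ᶠ w in 𝓝 T, divR P W (w 1) < E :=
    ((continuous_divR P W).comp (hp 1)).continuousAt.eventually (gt_mem_nhds hD)
  have h2 : ∀ᶠ w in 𝓝 T, mi (w 2) < R := by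
    refine (hmic.comp (hp 2)).continuousAt.eventually (gt_mem_nhds ?_)
    exact (mutualInfo_eq hQt.1.1.1).symm.trans_lt hI
  have h3 : ∀ᶠ w in 𝓝 T, divR P W (w 2) + mi (w 0) - R < s := by
    refine ((((continuous_divR P W).comp (hp 2)).add (hmic.comp (hp 0))).sub
      continuous_const).continuousAt.eventually (gt_mem_nhds ?_)
    rw [mutualInfo_eq hQ.1.1.1] at hs'
    exact hs'
  have h4 : ∀ᶠ w in 𝓝 T, llr W Q' < llr W Q → llr W (w 1) < llr W (w 0) := by
    by_cases hlt : llr W Q' < llr W Q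
    · have hopen : IsOpen {w : Fin 3 → X × Y → ℝ | llr W (w 1) < llr W (w 0)} :=
        isOpen_lt ((continuous_llr W).comp (hp 1)) ((continuous_llr W).comp (hp 0))
      exact (hopen.eventually_mem (x := T) hlt).mono fun w hw _ => hw
    · exact Eventually.of_forall fun w hw => absurd hw hlt
  obtain ⟨N, hN, z, ⟨hz1, hz2, hz3, hz4⟩, hadm, hmarg⟩ := exists_types_mem_nhds (W := W) hP T
    (by intro i; fin_cases i <;> assumption)
    (by
      have : ∀ i, margY (T i) = margY Q := by
        intro i; fin_cases i
        · rfl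
        · exact hm'
        · exact hmt
      intro i j; rw [this, this])
    (h1.and (h2.and (h3.and h4)))
  refine (listExponent_joint_le_of_types hW hR hN (hadm 0) (hadm 1) (hadm 2) (hmarg 1 0)
    (hmarg 2 0) ?_ hz1 (by rw [mutualInfo_eq (hadm 2).1.1.1]; exact hz2) hE).trans ?_
  · rcases hf with hf | hf
    · exact (hz4 hf).le
    · exact (hf _ (hadm 1) _ (hadm 0) (hmarg 1 0)).le
  · rw [mutualInfo_eq (hadm 0).1.1.1]
    exact_mod_cast hz3.le

/-- Convex combination of two distributions. -/
def mix (t : ℝ) (A B : X × Y → ℝ) : X × Y → ℝ := (1 - t) • A + t • B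

theorem continuous_mix (A B : X × Y → ℝ) : Continuous fun t => mix t A B := by
  unfold mix; fun_prop

theorem mix_zero (A B : X × Y → ℝ) : mix 0 A B = A := by simp [mix]

theorem mix_mem {A B : X × Y → ℝ} (hA : A ∈ admissible P W) (hB : B ∈ admissible P W) {t : ℝ}
    (h0 : 0 ≤ t) (h1 : t ≤ 1) : mix t A B ∈ admissible P W :=
  convex_admissible hA hB (by linarith) h0 (by ring)

theorem margY_mix (t : ℝ) (A B : X × Y → ℝ) :
    margY (mix t A B) = (1 - t) • margY A + t • margY B := by
  rw [mix, margY_add, margY_smul, margY_smul]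

theorem llr_mix (t : ℝ) (A B : X × Y → ℝ) :
    llr W (mix t A B) = (1 - t) * llr W A + t * llr W B := by
  rw [mix, llr_add, llr_smul, llr_smul]

/-- The open interval `(0, 1)` near `0`. -/
theorem eventually_mem_Ioo : ∀ᶠ t : ℝ in 𝓝[>] 0, 0 < t ∧ t < 1 :=
  (eventually_mem_nhdsWithin).and
    (((gt_mem_nhds zero_lt_one).filter_mono nhdsWithin_le_nhds : ∀ᶠ t : ℝ in 𝓝[>] 0, t < 1))

/-- This supplies a direction of perturbation. If the likelihood varies within some fibre of the
output marginal, mixing two such points into `channelDist P W`, which has divergence `0`, keeps a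
likelihood gap and brings the divergence below `E`. -/
theorem exists_pair_llr_lt_or_const (hP : P ∈ stdSimplex ℝ X) (hW : ∀ x, W x ∈ stdSimplex ℝ Y)
    {E : ℝ} (hE : 0 < E) :
    ∃ A ∈ admissible P W, ∃ B ∈ admissible P W, margY A = margY B ∧ divR P W B < E ∧
      llr W B ≤ llr W A ∧
      (llr W B < llr W A ∨ ∀ A ∈ admissible P W, ∀ B ∈ admissible P W, margY A = margY B →
        llr W A = llr W B) := by
  have hC := channelDist_mem hP hW
  have hC0 := divR_channelDist (P := P) hW
  by_cases hc : ∀ A ∈ admissible P W, ∀ B ∈ admissible P W, margY A = margY B →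
      llr W A = llr W B
  · exact ⟨_, hC, _, hC, rfl, by rw [hC0]; exact hE, le_rfl, Or.inr hc⟩
  · obtain ⟨A, hA, B, hB, hm, hlt⟩ : ∃ A ∈ admissible P W, ∃ B ∈ admissible P W,
        margY A = margY B ∧ llr W B < llr W A := by
      push Not at hc
      obtain ⟨A, hA, B, hB, hm, hne⟩ := hc
      rcases hne.lt_or_gt with h | h
      · exact ⟨B, hB, A, hA, hm.symm, h⟩
      · exact ⟨A, hA, B, hB, hm, h⟩
    have h1 : ∀ᶠ t : ℝ in 𝓝[>] 0, divR P W (mix t (channelDist P W) B) < E := by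
      refine Eventually.filter_mono nhdsWithin_le_nhds ?_
      refine ((continuous_divR P W).comp (continuous_mix _ _)).continuousAt.eventually
        (gt_mem_nhds ?_)
      simp only [Function.comp_apply, mix_zero, hC0]
      exact hE
    obtain ⟨t, ht1, ht0, ht⟩ := (h1.and eventually_mem_Ioo).exists
    have hlt' : llr W (mix t (channelDist P W) B) < llr W (mix t (channelDist P W) A) := by
      rw [llr_mix, llr_mix]; nlinarith
    exact ⟨mix t (channelDist P W) A, mix_mem hC hA ht0.le ht.le, mix t (channelDist P W) B,
      mix_mem hC hB ht0.le ht.le, by rw [margY_mix, margY_mix, hm], ht1, hlt'.le, Or.inl hlt'⟩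

/-- Mixing `Q`, `Q'`, `Qt` with weight `t` towards `A`, `B`, `At` keeps the common marginal and
turns the weak constraints into those of `listExponent_joint_le`; then `t → 0`. -/
theorem listExponent_joint_le_of_feasible (hP : ∃ n : ℕ, 0 < n ∧ (typeClass P n).Nonempty)
    (hW : ∀ x, W x ∈ stdSimplex ℝ Y) {R E : ℝ} (hR : 0 < R) (hE0 : 0 < E)
    {h : (X × Y → ℝ) → EReal} {Q Q' Qt : X × Y → ℝ}
    (hQ : Q ∈ admissible P W) (hQ' : Q' ∈ admissible P W)
    (hQt : Qt ∈ admissible P W) (hm' : margY Q' = margY Q) (hmt : margY Qt = margY Q)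
    (hf : llr W Q' ≤ llr W Q) (hD : divR P W Q' ≤ E) (hI : mutualInfo Qt ≤ R)
    (hedge : mutualInfo Qt = R → ∀ x y, 0 < W x y)
    (hE : (E : EReal) ≤ errorExponent P W R (jointThresholdDecoder W h)) :
    listExponent P W R (jointThresholdDecoder W h) ≤
      ((divR P W Qt + mutualInfo Q - R : ℝ) : EReal) := by
  have hPs : P ∈ stdSimplex ℝ X := by rw [← hQ.1.2]; exact margX_mem_stdSimplex hQ.1.1
  obtain ⟨A, hA, B, hB, hAB, hBE, hle, hor⟩ := exists_pair_llr_lt_or_const hPs hW hE0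
  set mi : (X × Y → ℝ) → ℝ := fun Q => ent (margX Q) + ent (margY Q) - ent Q with hmi
  have hmic : Continuous mi := ((continuous_ent.comp continuous_margX).add
    (continuous_ent.comp continuous_margY)).sub continuous_ent
  obtain ⟨At, hAt, hAtA, hAtI⟩ : ∃ At ∈ admissible P W, margY At = margY A ∧
      ∀ᶠ t : ℝ in 𝓝[>] 0, mutualInfo (mix t Qt At) < R := by
    rcases hI.lt_or_eq with hlt | heq
    · refine ⟨A, hA, rfl, ?_⟩
      have h1 : ∀ᶠ t : ℝ in 𝓝[>] 0, mi (mix t Qt A) < R := by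
        refine Eventually.filter_mono nhdsWithin_le_nhds ?_
        refine (hmic.comp (continuous_mix _ _)).continuousAt.eventually (gt_mem_nhds ?_)
        simp only [Function.comp_apply, mix_zero]
        exact (mutualInfo_eq hQt.1.1.1).symm.trans_lt hlt
      filter_upwards [h1, eventually_mem_Ioo] with t ht1 ht2
      rw [mutualInfo_eq (mix_mem hQt hA ht2.1.le ht2.2.le).1.1.1]
      exact ht1
    -- On the boundary the product distribution lowers the mutual information to at most `(1 - t) R
    -- < R`. It is admissible because no transition is forbidden.
    · have hpos := hedge heq
      have hAY := margY_mem_stdSimplex hA.1.1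
      have hmX : margX (fun a : X × Y => P a.1 * margY A a.2) = P := by
        ext x; simp only [margX, ← Finset.mul_sum, hAY.2, mul_one]
      refine ⟨fun a => P a.1 * margY A a.2, ⟨⟨⟨fun a => mul_nonneg (hPs.1 _) (hAY.1 _), ?_⟩,
        hmX⟩, fun x y hxy => absurd hxy (hpos x y).ne'⟩, ?_, ?_⟩
      · rw [sum_eq_sum_margX, hmX, hPs.2]
      · ext y
        change ∑ x, P x * margY A y = margY A y
        rw [← Finset.sum_mul, hPs.2, one_mul]
      · filter_upwards [eventually_mem_Ioo] with t ht
        refine (mutualInfo_mix_prod_le hPs hQt.1 hAY ht.1.le ht.2.le).trans_lt ?_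
        rw [heq]; nlinarith [ht.1]
  have hlim : Tendsto (fun t : ℝ => ((divR P W (mix t Qt At) + mi (mix t Q A) - R : ℝ) : EReal))
      (𝓝[>] 0) (𝓝 ((divR P W Qt + mutualInfo Q - R : ℝ) : EReal)) := by
    have hc : Continuous fun t : ℝ => divR P W (mix t Qt At) + mi (mix t Q A) - R :=
      (((continuous_divR P W).comp (continuous_mix _ _)).add
        (hmic.comp (continuous_mix _ _))).sub continuous_const
    have := (continuous_coe_real_ereal.comp hc).tendsto 0
    simp only [Function.comp_apply, mix_zero] at this
    rw [mutualInfo_eq hQ.1.1.1]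
    exact this.mono_left nhdsWithin_le_nhds
  refine ge_of_tendsto hlim ?_
  filter_upwards [hAtI, eventually_mem_Ioo] with t htI ht
  have hQm := mix_mem hQ hA ht.1.le ht.2.le
  have := listExponent_joint_le hP hW hR (Q := mix t Q A) (Q' := mix t Q' B) (Qt := mix t Qt At)
    hQm (mix_mem hQ' hB ht.1.le ht.2.le) (mix_mem hQt hAt ht.1.le ht.2.le)
    (by rw [margY_mix, margY_mix, hm', hAB]) (by rw [margY_mix, margY_mix, hmt, hAtA])
    (by
      refine hor.imp_left fun hlt => ?_
      rw [llr_mix, llr_mix]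
      nlinarith [ht.1, ht.2])
    (by
      have h1 := (strictConvexOn_divR (P := P) (W := W)).convexOn.2 hQ' hB
        (by linarith [ht.2] : (0 : ℝ) ≤ 1 - t) ht.1.le (by ring)
      simp only [smul_eq_mul] at h1
      refine h1.trans_lt ?_
      nlinarith [ht.1, ht.2])
    htI hE
  rwa [mutualInfo_eq hQm.1.1.1] at this

end Converse

/-! ### Reduction of the joint class to the output class -/

section Reduction

variable {X Y : Type*} [Fintype X] [DecidableEq X] [Fintype Y] [DecidableEq Y]
  {P : X → ℝ} {W : X → Y → ℝ}

open Classical in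
/-- The threshold on joint distributions that looks at the `Y`-marginal only. -/
def liftThreshold (g : (Y → ℝ) → EReal) (Q : X × Y → ℝ) : EReal :=
  if Q ∈ stdSimplex ℝ (X × Y) then g (margY Q) else ⊤

theorem isThreshold_liftThreshold {g : (Y → ℝ) → EReal} (hg : IsThreshold g) :
    IsThreshold (liftThreshold (X := X) g) := by
  obtain ⟨G, -, hc, hcont, hreal, htop⟩ := hg
  refine ⟨stdSimplex ℝ (X × Y) ∩ margY ⁻¹' G, Set.inter_subset_left,
    (isCompact_stdSimplex ℝ _).inter_right (hc.isClosed.preimage continuous_margY), ?_, ?_, ?_⟩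
  · refine (hcont.comp continuous_margY.continuousOn fun Q hQ => hQ.2).congr fun Q hQ => ?_
    exact if_pos hQ.1
  · intro Q hQ
    rw [liftThreshold, if_pos hQ.1]
    exact hreal _ hQ.2
  · intro Q hQ
    by_cases h : Q ∈ stdSimplex ℝ (X × Y)
    · rw [liftThreshold, if_pos h]
      exact htop _ fun h' => hQ ⟨h, h'⟩
    · exact if_neg h

theorem liftThreshold_jointEmpDist {n : ℕ} (hn : 0 < n) (g : (Y → ℝ) → EReal) (x : Fin n → X)
    (y : Fin n → Y) : liftThreshold g (jointEmpDist x y) = g (empDist y) := by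
  rw [liftThreshold, if_pos (show jointEmpDist x y ∈ stdSimplex ℝ (X × Y) from
    empDist_mem_stdSimplex hn _), margY_jointEmpDist]

/-- With a single codeword the supremum over competitors is empty and the lifted decoder always
lists it, so the inclusion can be strict. -/
theorem outputThresholdDecoder_subset {n M : ℕ} (hn : 0 < n) (g : (Y → ℝ) → EReal)
    (C : Fin M → Fin n → X) (y : Fin n → Y) :
    outputThresholdDecoder W g n M C y ⊆
      jointThresholdDecoder W (liftThreshold g) n M C y := by
  intro m hm
  simp only [outputThresholdDecoder, jointThresholdDecoder, Finset.mem_filter, Finset.mem_univ,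
    true_and, iSup_le_iff, liftThreshold_jointEmpDist hn] at hm ⊢
  exact fun _ _ => hm

/-- The second message is a competitor, so the supremum is over a nonempty set and equals the output
threshold. -/
theorem mem_jointThresholdDecoder_iff {n M : ℕ} (hn : 0 < n) (g : (Y → ℝ) → EReal)
    (C : Fin M → Fin n → X) (y : Fin n → Y) {l m : Fin M} (h : l ≠ m) :
    l ∈ jointThresholdDecoder W (liftThreshold g) n M C y ↔
      l ∈ outputThresholdDecoder W g n M C y := by
  refine ⟨fun hl => ?_, fun hl => outputThresholdDecoder_subset hn g C y hl⟩
  simp only [outputThresholdDecoder, jointThresholdDecoder, Finset.mem_filter, Finset.mem_univ,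
    true_and, iSup_le_iff, liftThreshold_jointEmpDist hn] at hl ⊢
  exact hl m h.symm

theorem errorExponent_le_lift (hW : ∀ x, W x ∈ stdSimplex ℝ Y) (R : ℝ) (g : (Y → ℝ) → EReal) :
    errorExponent P W R (outputThresholdDecoder W g) ≤
      errorExponent P W R (jointThresholdDecoder W (liftThreshold g)) := by
  refine decayExponent_mono ?_
  filter_upwards [eventually_blocklengths P] with n hn
  refine ensembleAvg_mono fun C _ => mul_le_mul_of_nonneg_left
    (Finset.sum_le_sum fun m _ => Finset.sum_le_sum fun y _ => ?_) (by positivity)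
  by_cases h : m ∈ outputThresholdDecoder W g n (numCodewords R n) C y
  · rw [if_pos h, if_pos (outputThresholdDecoder_subset hn.1 g C y h)]
  · rw [if_neg h]
    split_ifs
    · exact vecProb_nonneg hW _ _
    · exact le_rfl

theorem listExponent_lift (R : ℝ) (g : (Y → ℝ) → EReal) :
    listExponent P W R (jointThresholdDecoder W (liftThreshold g)) =
      listExponent P W R (outputThresholdDecoder W g) := by
  have : ∀ᶠ n in blocklengths P,
      ensembleAvg P n (numCodewords R n)
        (fun C => listSize W (jointThresholdDecoder W (liftThreshold g)) C) =
      ensembleAvg P n (numCodewords R n) (fun C => listSize W (outputThresholdDecoder W g) C) := by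
    filter_upwards [eventually_blocklengths P] with n hn
    congr 1
    ext1 C
    unfold listSize
    refine Finset.sum_congr rfl fun y _ => ?_
    congr 1
    refine Finset.sum_congr rfl fun m _ => ?_
    congr 1
    refine Finset.sum_congr rfl fun l hl => ?_
    simp only [mem_jointThresholdDecoder_iff hn.1 g C y (Finset.mem_filter.1 hl).2]
  exact le_antisymm (decayExponent_mono (this.mono fun n h => h.symm.le))
    (decayExponent_mono (this.mono fun n h => h.le))

/-- There is at most one codeword, hence no wrong message. -/
theorem listExponent_eq_top_of_nonpos {R : ℝ} (hR : R ≤ 0) (φ : Decoder X Y) :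
    listExponent P W R φ = ⊤ := by
  refine decayExponent_eq_top (Eventually.of_forall fun n => ?_)
  have hM := numCodewords_le_one hR n
  have h0 : ∀ C : Fin (numCodewords R n) → Fin n → X, listSize W φ C = 0 := by
    intro C
    have : Subsingleton (Fin (numCodewords R n)) := Fin.subsingleton_iff_le_one.2 hM
    unfold listSize
    refine Finset.sum_eq_zero fun y _ => ?_
    rw [Finset.sum_eq_zero fun m _ => ?_, mul_zero]
    rw [Finset.filter_false_of_mem fun l _ => not_not.2 (Subsingleton.elim l m),
      Finset.sum_empty, mul_zero]
  simp only [h0]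
  exact (Finset.expect_const_zero _).le

theorem logLik_ne_top (hW : ∀ x, W x ∈ stdSimplex ℝ Y) {Q : X × Y → ℝ} (hQ : ∀ a, 0 ≤ Q a) :
    logLik W Q ≠ ⊤ := by
  by_cases h : logLik W Q = ⊥
  · rw [h]; exact bot_ne_top
  · rw [logLik_eq_coe hW (eq_zero_of_logLik_ne_bot hQ h)]
    exact EReal.coe_ne_top _

theorem isThreshold_top : IsThreshold (⊤ : (Y → ℝ) → EReal) :=
  ⟨∅, Set.empty_subset _, isCompact_empty, continuousOn_empty _, by simp, fun _ _ => rfl⟩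

/-- The threshold `⊤` always gives an empty list, because log-likelihoods are never `⊤`. -/
theorem listExponent_top (hW : ∀ x, W x ∈ stdSimplex ℝ Y) (R : ℝ) :
    listExponent P W R (outputThresholdDecoder W ⊤) = ⊤ := by
  refine decayExponent_eq_top (Eventually.of_forall fun n => ?_)
  have h0 : ∀ C : Fin (numCodewords R n) → Fin n → X,
      listSize W (outputThresholdDecoder W ⊤) C = 0 := by
    intro C
    unfold listSize
    refine Finset.sum_eq_zero fun y _ => ?_
    rw [Finset.sum_eq_zero fun m _ => ?_, mul_zero]
    rw [Finset.sum_eq_zero fun l _ => if_neg ?_, mul_zero]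
    simp only [outputThresholdDecoder, Finset.mem_filter, Finset.mem_univ, true_and,
      Pi.top_apply, top_le_iff]
    exact logLik_ne_top hW (empDist_nonneg _)
  simp only [h0]
  exact (Finset.expect_const_zero _).le

theorem le_errorExponent_output_of_nonpos (hW : ∀ x, W x ∈ stdSimplex ℝ Y) (R : ℝ) {E : ℝ}
    (hE : E ≤ 0) (g : (Y → ℝ) → EReal) :
    (E : EReal) ≤ errorExponent P W R (outputThresholdDecoder W g) := by
  classical
  refine le_decayExponent fun s hs => ?_
  filter_upwards [eventually_blocklengths P] with n hn
  refine (ensembleAvg_errorProb_output_le hW hn.2 g).trans ?_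
  have h1 : (1 : ℝ) ≤ Real.exp (-(n * s)) := by
    rw [Real.one_le_exp_iff]
    have : (0 : ℝ) ≤ n := n.cast_nonneg
    nlinarith
  refine (Finset.expect_le hn.2 fun x _ => ?_).trans h1
  refine (Finset.sum_le_sum fun y _ => ?_).trans_eq (sum_vecProb hW x)
  refine mul_le_of_le_one_right (vecProb_nonneg hW x y) ?_
  split_ifs <;> norm_num

/-- Lifting carries each output threshold to a joint one with equal list exponent and no smaller
error exponent. Domination over joint thresholds therefore settles both classes. -/
theorem optimal_of_forall_joint_le (hW : ∀ x, W x ∈ stdSimplex ℝ Y) {R E : ℝ}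
    {g : (Y → ℝ) → EReal} (hg : IsThreshold g)
    (hE : (E : EReal) ≤ errorExponent P W R (outputThresholdDecoder W g))
    (hbest : ∀ h : (X × Y → ℝ) → EReal,
      (E : EReal) ≤ errorExponent P W R (jointThresholdDecoder W h) →
      listExponent P W R (jointThresholdDecoder W h) ≤
        listExponent P W R (outputThresholdDecoder W g)) :
    (∃ φ, IsOptimalDecoder (classLambdaOne W) P W R E φ) ∧
    (∃ ψ, IsOptimalDecoder (classPsi W) P W R E ψ) ∧
    optimalListExponent (classLambdaOne W) P W R E = optimalListExponent (classPsi W) P W R E := by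
  have hΨ : IsOptimalDecoder (classPsi W) P W R E
      (jointThresholdDecoder W (liftThreshold g)) := by
    refine ⟨⟨_, isThreshold_liftThreshold hg, rfl⟩, hE.trans (errorExponent_le_lift hW R g), ?_⟩
    rintro _ ⟨h, -, rfl⟩ hψ
    rw [listExponent_lift]
    exact hbest h hψ
  have hΛ : IsOptimalDecoder (classLambdaOne W) P W R E (outputThresholdDecoder W g) := by
    refine ⟨⟨g, hg, rfl⟩, hE, ?_⟩
    rintro _ ⟨g', -, rfl⟩ hψ
    rw [← listExponent_lift]
    exact hbest _ (hψ.trans (errorExponent_le_lift hW R g'))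
  have hopt : ∀ {K : Set (Decoder X Y)} {φ : Decoder X Y}, IsOptimalDecoder K P W R E φ →
      optimalListExponent K P W R E = listExponent P W R φ := by
    intro K φ hφ
    refine le_antisymm (sSup_le ?_) (le_sSup ⟨φ, hφ.1, hφ.2.1, rfl⟩)
    rintro _ ⟨ψ, h1, h2, rfl⟩
    exact hφ.2.2 ψ h1 h2
  exact ⟨⟨_, hΛ⟩, ⟨_, hΨ⟩, by rw [hopt hΛ, hopt hΨ, listExponent_lift]⟩

end Reduction

/-! ### Feasible pairs of the minimization -/

section Critical

variable {X Y : Type*} [Fintype X] [DecidableEq X] [Fintype Y] [DecidableEq Y]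
  {P : X → ℝ} {W : X → Y → ℝ}

/-- A distribution above the optimal threshold is admissible, and some distribution with the same
marginals, of divergence at most `E`, has no larger log-likelihood. -/
theorem exists_minimizer_of_threshold_le (hW : ∀ x, W x ∈ stdSimplex ℝ Y) {E : ℝ}
    {Q : X × Y → ℝ} (hQ : Q ∈ jointDist P)
    (hle : optimalOutputThreshold P W E (margY Q) ≤ logLik W Q) :
    Q ∈ admissible P W ∧ ∃ Q' ∈ divBall P W E, margY Q' = margY Q ∧ llr W Q' ≤ llr W Q := by
  have hmem : margY Q ∈ margY '' divBall P W E := by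
    by_contra hno
    rw [optimalOutputThreshold_eq_top hno, top_le_iff] at hle
    exact logLik_ne_top hW hQ.1.1 hle
  obtain ⟨Q', hQ', hm, heq⟩ := exists_optimalOutputThreshold_eq hW hmem
  rw [heq] at hle
  have hadm : Q ∈ admissible P W := ⟨hQ, eq_zero_of_logLik_ne_bot hQ.1.1 fun hb =>
    EReal.coe_ne_bot _ (le_bot_iff.1 (hb ▸ hle))⟩
  rw [logLik_eq_coe hW hadm.2] at hle
  exact ⟨hadm, Q', hQ', hm, by exact_mod_cast hle⟩

end Critical

end

end ErasureList

/-! ### The main theorem -/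

theorem proposition2 {X Y : Type*} [Fintype X] [DecidableEq X] [Fintype Y] [DecidableEq Y]
    (P : X → ℝ) (W : X → Y → ℝ)
    (hP : ∃ n : ℕ, 0 < n ∧ (ErasureList.typeClass P n).Nonempty)
    (hW : ∀ x, W x ∈ stdSimplex ℝ Y)
    (E R Rcr : ℝ) (hcr : ErasureList.IsCriticalRate P W E Rcr) (hR : Rcr ≤ R)
    (hedge : R = Rcr → ∀ x y, 0 < W x y) :
    (∃ φ, ErasureList.IsOptimalDecoder (ErasureList.classLambdaOne W) P W R E φ) ∧
    (∃ ψ, ErasureList.IsOptimalDecoder (ErasureList.classPsi W) P W R E ψ) ∧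
    ErasureList.optimalListExponent (ErasureList.classLambdaOne W) P W R E =
      ErasureList.optimalListExponent (ErasureList.classPsi W) P W R E := by
  open ErasureList in
  rcases le_or_gt E 0 with hE | hE
  -- A target `E ≤ 0` constrains nothing, and the decoder with empty lists has infinite list
  -- exponent.
  · refine optimal_of_forall_joint_le hW isThreshold_top
      (le_errorExponent_output_of_nonpos hW R hE _) fun h _ => ?_
    rw [listExponent_top hW]
    exact le_top
  refine optimal_of_forall_joint_le hW (isThreshold_optimalOutputThreshold (P := P) (E := E) hW)
    (le_errorExponent_optimal hW R E) fun h hh => ?_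
  rcases le_or_gt R 0 with hR0 | hR0
  · rw [listExponent_eq_top_of_nonpos hR0, listExponent_eq_top_of_nonpos hR0]
  obtain ⟨⟨Qt, Q⟩, ⟨hQt, hQ, hm, hle⟩, hmin, rfl⟩ := hcr
  obtain ⟨hQa, Q', hQ', hm', hf⟩ := exists_minimizer_of_threshold_le hW hQ hle
  -- Replacing `Qt` by `Q'` keeps the pair feasible with a finite objective, so the optimal value is
  -- finite and `Qt` charges no forbidden transition.
  have hQta : Qt ∈ admissible P W := by
    refine admissible_of_condDiv_ne_top hQt fun htop => ?_
    have := hmin (Q', Q) ⟨hQ'.1.1, hQ, hm'.symm, hle⟩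
    simp only [htop, condDiv_eq_coe hQ'.1] at this
    rw [EReal.top_add_coe, top_le_iff, ← EReal.coe_add] at this
    exact EReal.coe_ne_top _ this
  refine (listExponent_joint_le_of_feasible hP hW hR0 hE hQa hQ'.1 hQta hm' hm.symm hf hQ'.2 hR
    (fun heq => hedge heq.symm) hh).trans (le_listExponent_optimal hW R fun Q₁ h₁ Q₂ h₂ h₁₂ hle₂ => ?_)
  -- Optimality makes the objective at `(Qt, Q)` a lower bound over all feasible pairs, so converse
  -- and achievability meet.
  have := hmin (Q₁, Q₂) ⟨h₁.1, h₂.1, h₁₂, hle₂⟩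
  simp only [condDiv_eq_coe hQta, condDiv_eq_coe h₁] at this
  exact_mod_cast this
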